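/- **Problems.** An ATSP instance $G=(V,d)$ is a complete directed graph on $n=|V|\ge 1$ vertices with real arc weights satisfying $d(u,u)=0$ and $d(u,v)\le d(u,w)+d(w,v)$ for all $u,v,w\in V$. A solution (tour) is a Hamiltonian cycle, its length is the total weight of its arcs, and $|OPT|$ is the minimum length. A No-Wait-Flowshop instance $I$ consists of $N\ge 1$ jobs and $m\ge 1$ machines with processing times $t_{jk}\in\mathbb{N}$ of job $j$ on machine $k$. With $$\delta(i,j)=\max_{1\le q\le m}\Big\{\sum_{k=1}^{q}t_{ik}-\sum_{k=1}^{q-1}t_{jk}\Big\},\qquad L(j)=\sum_{k=1}^m t_{jk},$$ the makespan of the no-wait schedule that processes the jobs in the order of the permutation $\sigma$ is $$C_{\max}(\sigma)=\sum_{k=1}^{N-1}\delta(\sigma_k,\sigma_{k+1})+L(\sigma_N).$$ A permutation $\sigma$ is an $\alpha$-approximate solution of $I$ ($\alpha\ge 1$) if $C_{\max}(\sigma)\le\alpha\min_{\sigma'}C_{\max}(\sigma')$. The size of $I$ is $\sum_{j,k}(1+\mathrm{len}(t_{jk}))$, where $\mathrm{len}$ is the binary length. **Model of computation.** Algorithms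 are programs of a random access machine whose cells hold natural numbers or exact real numbers, whose addresses are natural numbers, and whose elementary operations (assignments, additions, subtractions, comparisons, conditional branching) each cost one time unit; multiplication, division and rounding are not available, and the only constants are natural numbers. In particular the running times below do not depend on the magnitude of the arc weights. **Theorem.** 1. There are an absolute constant $C$, a polynomial bound $p(n,1/\varepsilon)=c\,(n+1/\varepsilon+1)^k$ and two algorithms such that, for every ATSP instance $G$ with $n$ vertices and every real $\varepsilon>0$, the following holds. Given $G$ and $\varepsilon$, the first algorithm constructs in time at most $p(n,1/\varepsilon)$ a No-Wait-Flowshop instance $I$ of size at most $p(n,1/\varepsilon)$. Given $G$, $\varepsilon$ and any permutation $\sigma$ of the jobs of $I$, the second algorithm constructs in time at most $p(n,1/\varepsilon)$ a tour $\tau$ of $G$ such that, for every $\alpha\ge 1$ for which $\sigma$ is an $\alpha$-approximate solution of $I$, the length of $\tau$ is at most $\alpha(1+C\varepsilon)\,|OPT|$. 2. Consequently, for every real $\alpha\ge 1$: if there is an algorithm that finds an $\alpha$-approximate solution of every No-Wait-Flowshop instance in time polynomial in the size of the instance, then there is an algorithm that, given an ATSP instance $G$ with $n$ vertices and any real $\varepsilon>0$,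 finds in time polynomial in $n$ and $1/\varepsilon$ a tour of $G$ of length at most $\alpha(1+\varepsilon)\,|OPT|$. -/

import Mathlib

namespace FlowshopATSP

/-! ### The asymmetric traveling salesman problem -/

/-- An instance of ATSP: a complete directed graph on the vertex set `Fin n` with real arc weights
that satisfy the semimetric properties. -/
structure ATSP where
  n : ℕ
  n_pos : 0 < n
  d : Fin n → Fin n → ℝ
  d_self : ∀ u, d u u = 0
  triangle : ∀ u w v, d u v ≤ d u w + d w v

/-- The length of the Hamiltonian cycle that visits the vertices in the cyclic order
`τ 0, τ 1, …, τ (n - 1), τ 0`. -/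
def ATSP.tourLength (G : ATSP) (τ : Equiv.Perm (Fin G.n)) : ℝ :=
  ∑ k : Fin G.n, G.d (τ k) (τ (finRotate G.n k))

/-- The value of an optimal tour. -/
noncomputable def ATSP.opt (G : ATSP) : ℝ :=
  Finset.univ.inf' Finset.univ_nonempty G.tourLength

/-! ### The no-wait flowshop problem -/

/-- An instance of no-wait flowshop: `time j k` is the processing time of job `j` on machine `k`. -/
structure NWFS where
  jobs : ℕ
  machines : ℕ
  jobs_pos : 0 < jobs
  machines_pos : 0 < machines
  time : Fin jobs → Fin machines → ℕ

/-- The total processing time of a job. -/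
def NWFS.jobLength (I : NWFS) (j : Fin I.jobs) : ℤ := ∑ k, (I.time j k : ℤ)

/-- The minimum delay between the start of job `i` and the start of job `j` when `j` is processed
directly after `i`:
`δ(i,j) = max over q of (∑ k ≤ q, time i k) - (∑ k < q, time j k)`. -/
def NWFS.delay (I : NWFS) (i j : Fin I.jobs) : ℤ :=
  Finset.univ.sup' (⟨⟨0, I.machines_pos⟩, Finset.mem_univ _⟩ :
      (Finset.univ : Finset (Fin I.machines)).Nonempty)
    (fun q => ∑ k ∈ Finset.Iic q, (I.time i k : ℤ) - ∑ k ∈ Finset.Iio q, (I.time j k : ℤ))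

/-- The makespan of the no-wait permutation schedule that processes the jobs in the order
`σ 0, σ 1, …`: the sum of the delays between consecutive jobs plus the length of the last job. -/
def NWFS.makespan (I : NWFS) (σ : Equiv.Perm (Fin I.jobs)) : ℤ :=
  ∑ k : Fin I.jobs,
    if h : (k : ℕ) + 1 < I.jobs then I.delay (σ k) (σ ⟨k + 1, h⟩) else I.jobLength (σ k)

/-- The minimum makespan. -/
def NWFS.opt (I : NWFS) : ℤ := Finset.univ.inf' Finset.univ_nonempty I.makespan

/-- `σ` is an `α`-approximate solution. -/
def NWFS.IsApprox (I : NWFS) (α : ℝ) (σ : Equiv.Perm (Fin I.jobs)) : Prop :=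
  (I.makespan σ : ℝ) ≤ α * (I.opt : ℝ)

/-- The size of an instance: one unit per operation plus the binary lengths of all processing
times. -/
def NWFS.size (I : NWFS) : ℕ := ∑ j, ∑ k, (Nat.size (I.time j k) + 1)

/-! ### The machine model

A random access machine with two kinds of memory cells, for natural numbers and for real numbers.
Memory is organised in arrays with a fixed name and two run-time indices, which are natural numbers.
The only arithmetic operations are addition, subtraction and comparison, and the only constants are
natural numbers. -/

structure State where
  nat : ℕ → ℕ → ℕ → ℕ
  real : ℕ → ℕ → ℕ → ℝ

/-- Expressions for natural numbers; subtraction is truncated at zero. -/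
inductive NExp where
  | const (c : ℕ)
  | read (x : ℕ) (i j : NExp)
  | add (a b : NExp)
  | sub (a b : NExp)

def NExp.eval (s : State) : NExp → ℕ
  | .const c => c
  | .read x i j => s.nat x (i.eval s) (j.eval s)
  | .add a b => a.eval s + b.eval s
  | .sub a b => a.eval s - b.eval s

/-- Expressions for real numbers. -/
inductive RExp where
  | const (c : ℕ)
  | read (x : ℕ) (i j : NExp)
  | add (a b : RExp)
  | sub (a b : RExp)

noncomputable def RExp.eval (s : State) : RExp → ℝ
  | .const c => (c : ℝ)
  | .read x i j => s.real x (i.eval s) (j.eval s)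
  | .add a b => a.eval s + b.eval s
  | .sub a b => a.eval s - b.eval s

/-- Tests. -/
inductive Test where
  | natLe (a b : NExp)
  | realLe (a b : RExp)
  | not (b : Test)
  | and (b c : Test)

def Test.eval (s : State) : Test → Prop
  | .natLe a b => a.eval s ≤ b.eval s
  | .realLe a b => a.eval s ≤ b.eval s
  | .not b => ¬ b.eval s
  | .and b c => b.eval s ∧ c.eval s

/-- Programs. -/
inductive Program where
  | skip
  | setNat (x : ℕ) (i j : NExp) (e : NExp)
  | setReal (x : ℕ) (i j : NExp) (e : RExp)
  | seq (p q : Program)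
  | ite (b : Test) (p q : Program)
  | loop (b : Test) (p : Program)

def State.setNat (s : State) (x i j v : ℕ) : State where
  nat := fun x' i' j' => if x' = x ∧ i' = i ∧ j' = j then v else s.nat x' i' j'
  real := s.real

noncomputable def State.setReal (s : State) (x i j : ℕ) (v : ℝ) : State where
  nat := s.nat
  real := fun x' i' j' => if x' = x ∧ i' = i ∧ j' = j then v else s.real x' i' j'

/-- `Exec p s s' T`: started in memory state `s`, the program `p` halts in memory state `s'` after
`T` steps. Every executed assignment (or `skip`) and every evaluated test counts as one step; the
expressions that occur have a size that is fixed by the program, so that this is, up to a constant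
factor, the number of elementary operations. -/
inductive Exec : Program → State → State → ℕ → Prop where
  | skip (s : State) : Exec .skip s s 1
  | setNat (s : State) (x : ℕ) (i j e : NExp) :
      Exec (.setNat x i j e) s (s.setNat x (i.eval s) (j.eval s) (e.eval s)) 1
  | setReal (s : State) (x : ℕ) (i j : NExp) (e : RExp) :
      Exec (.setReal x i j e) s (s.setReal x (i.eval s) (j.eval s) (e.eval s)) 1
  | seq {p q : Program} {s s' s'' : State} {T T' : ℕ} :
      Exec p s s' T → Exec q s' s'' T' → Exec (.seq p q) s s'' (T + T')
  | iteTrue {b : Test} {p q : Program} {s s' : State} {T : ℕ} :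
      b.eval s → Exec p s s' T → Exec (.ite b p q) s s' (T + 1)
  | iteFalse {b : Test} {p q : Program} {s s' : State} {T : ℕ} :
      ¬ b.eval s → Exec q s s' T → Exec (.ite b p q) s s' (T + 1)
  | loopDone {b : Test} {p : Program} {s : State} :
      ¬ b.eval s → Exec (.loop b p) s s 1
  | loopStep {b : Test} {p : Program} {s s' s'' : State} {T T' : ℕ} :
      b.eval s → Exec p s s' T → Exec (.loop b p) s' s'' T' →
      Exec (.loop b p) s s'' (T + T' + 1)

/-- Started in `s`, the program halts within `B` steps in a state that satisfies `post`. -/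
def Program.HaltsWithin (p : Program) (s : State) (B : ℝ) (post : State → Prop) : Prop :=
  ∃ s' T, Exec p s s' T ∧ (T : ℝ) ≤ B ∧ post s'

/-! ### Input and output conventions

Natural-number arrays: `0` the number of vertices, `1` the number of jobs, `2` the number of
machines, `3` the processing times, `4` a job order, `5` a vertex order.
Real arrays: `0` the arc weights, `1` the number `ε`. All other cells of an input are zero. -/

/-- The input that consists of `G` and `ε`. -/
noncomputable def ATSP.input (G : ATSP) (ε : ℝ) : State where
  nat := fun x i j => if x = 0 ∧ i = 0 ∧ j = 0 then G.n else 0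
  real := fun x i j =>
    if h : x = 0 ∧ i < G.n ∧ j < G.n then G.d ⟨i, h.2.1⟩ ⟨j, h.2.2⟩
    else if x = 1 ∧ i = 0 ∧ j = 0 then ε else 0

/-- The input that consists of `G`, `ε` and a job order. -/
noncomputable def ATSP.inputWithSchedule (G : ATSP) (ε : ℝ) {N : ℕ} (σ : Equiv.Perm (Fin N)) :
    State where
  nat := fun x i j =>
    if h : x = 4 ∧ i < N ∧ j = 0 then (σ ⟨i, h.2.1⟩ : ℕ) else (G.input ε).nat x i j
  real := (G.input ε).real

/-- The input that consists of a flowshop instance. -/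
def NWFS.input (I : NWFS) : State where
  nat := fun x i j =>
    if x = 1 ∧ i = 0 ∧ j = 0 then I.jobs
    else if x = 2 ∧ i = 0 ∧ j = 0 then I.machines
    else if h : x = 3 ∧ i < I.jobs ∧ j < I.machines then I.time ⟨i, h.2.1⟩ ⟨j, h.2.2⟩
    else 0
  real := fun _ _ _ => 0

/-- The memory contains the flowshop instance `I`. -/
def State.HoldsInstance (s : State) (I : NWFS) : Prop :=
  s.nat 1 0 0 = I.jobs ∧ s.nat 2 0 0 = I.machines ∧
    ∀ (j : Fin I.jobs) (k : Fin I.machines), s.nat 3 j k = I.time j k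

/-- The memory contains the job order `σ`. -/
def State.HoldsSchedule (s : State) {N : ℕ} (σ : Equiv.Perm (Fin N)) : Prop :=
  ∀ k : Fin N, s.nat 4 k 0 = (σ k : ℕ)

/-- The memory contains the vertex order `τ`. -/
def State.HoldsTour (s : State) {n : ℕ} (τ : Equiv.Perm (Fin n)) : Prop :=
  ∀ k : Fin n, s.nat 5 k 0 = (τ k : ℕ)

/-! ### Approximation algorithms -/

/-- A polynomial bound in `n` and `1 / ε`. -/
noncomputable def polyBound (c k n : ℕ) (ε : ℝ) : ℝ := c * ((n : ℝ) + 1 / ε + 1) ^ k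

/-- `A` is a polynomial-time `α`-approximation algorithm for no-wait flowshop. -/
def IsApproxAlgNWFS (α : ℝ) (A : Program) : Prop :=
  ∃ c k : ℕ, ∀ I : NWFS,
    A.HaltsWithin I.input (c * (I.size : ℝ) ^ k)
      (fun s => ∃ σ : Equiv.Perm (Fin I.jobs), s.HoldsSchedule σ ∧ I.IsApprox α σ)

/-- `B`, given `G` and `ε > 0`, finds an `α (1 + ε)`-approximate tour of `G` in time polynomial
in `n` and `1 / ε`. -/
def IsApproxSchemeATSP (α : ℝ) (B : Program) : Prop :=
  ∃ c k : ℕ, ∀ (G : ATSP) (ε : ℝ), 0 < ε →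
    B.HaltsWithin (G.input ε) (polyBound c k G.n ε)
      (fun s => ∃ τ : Equiv.Perm (Fin G.n), s.HoldsTour τ ∧
        G.tourLength τ ≤ α * (1 + ε) * G.opt)

end FlowshopATSP

/-! Adding the potential difference `d 0 u - d 0 v` to every arc leaves all tour lengths unchanged,
makes the weights nonnegative and makes the arcs out of vertex 0 free. The largest shifted weight
`diam` is then at most the length of any tour (`diam_le_tourLength`). So if it is scaled to P =
n⌈9/ε⌉ and all weights are rounded up to integers `w`, an error of O(1) per arc costs only a factor
1 + O(ε).

A job encodes a vector of n + 2P coordinates in [0, P]: its processing times are 1 plus the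
increments of a curve of slope at most one that climbs to each coordinate in turn and returns to 0.
The delay from x to y is then, up to an additive 2, the largest excess of a coordinate of x over
that of y (`flow_delay_le`, `le_flow_delay`). Vertex u is encoded by its distances w(u, q) to all
vertices, and by the triangle inequality its largest excess over v is w(u, v).

The instance has P² copies of the vertex set; copy (a, b) also puts w(u, 0) at two marker
coordinates given by a and b. Changing copies therefore costs about w(u, 0), the price of returning
to vertex 0, from which every arc is free. Two digits mark P² copies with only 2P extra coordinates,
so the length O(P²) of the last job amounts to O(1) per copy, which is small on the scale P of the
weights.

Every job order splits into one tour per copy, and their total weight is at most the makespan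
(`sum_weightLength_copyTour_le`). Conversely, following an optimal tour from vertex 0 in one copy
after another gives `flow_opt_le`. With the rounding estimates this yields `toNWFS_opt_mul_diam_le`,
and by averaging the shortest of the P² tours is good enough (`tourLength_copyTour_le`).

The algorithms are explicit programs, verified by time-bounded Hoare rules with a syntactic frame
condition; repeated addition replaces multiplication and rounding. In the second part the flowshop
algorithm runs with renamed arrays, so that it sees exactly its own input and leaves `G` and `ε`
intact (`Exec.rename`, `State.Built.pull_eq_input`). -/

namespace FlowshopATSP

/-! ### Total correctness with time bounds -/

/-- Started in `s`, the program halts within `T` steps in a state that satisfies `Q`. -/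
def Run (p : Program) (s : State) (T : ℕ) (Q : State → Prop) : Prop :=
  ∃ s' t, Exec p s s' t ∧ t ≤ T ∧ Q s'

/-- The program may write to the natural-number array `x`. -/
def Program.writesNat : Program → ℕ → Bool
  | .skip, _ => false
  | .setNat y _ _ _, x => x == y
  | .setReal _ _ _ _, _ => false
  | .seq p q, x => p.writesNat x || q.writesNat x
  | .ite _ p q, x => p.writesNat x || q.writesNat x
  | .loop _ p, x => p.writesNat x

/-- The program may write to the real array `x`. -/
def Program.writesReal : Program → ℕ → Bool
  | .skip, _ => false
  | .setNat _ _ _ _, _ => false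
  | .setReal y _ _ _, x => x == y
  | .seq p q, x => p.writesReal x || q.writesReal x
  | .ite _ p q, x => p.writesReal x || q.writesReal x
  | .loop _ p, x => p.writesReal x

/-- The states agree on all arrays that the program does not write to. -/
structure Frame (p : Program) (s s' : State) : Prop where
  nat : ∀ x, p.writesNat x = false → s'.nat x = s.nat x
  real : ∀ x, p.writesReal x = false → s'.real x = s.real x

theorem Frame.rfl (p : Program) (s : State) : Frame p s s :=
  ⟨fun _ _ => Eq.refl _, fun _ _ => Eq.refl _⟩

theorem Frame.trans {p : Program} {s s' s'' : State} (h : Frame p s s') (h' : Frame p s' s'') :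
    Frame p s s'' :=
  ⟨fun x hx => (h'.nat x hx).trans (h.nat x hx), fun x hx => (h'.real x hx).trans (h.real x hx)⟩

theorem State.setNat_nat_same (s : State) (x i j v : ℕ) :
    (s.setNat x i j v).nat x = fun i' j' => if i' = i ∧ j' = j then v else s.nat x i' j' := by
  simp [State.setNat]

theorem State.setNat_nat_of_ne (s : State) {x y : ℕ} (i j v : ℕ) (h : y ≠ x) :
    (s.setNat x i j v).nat y = s.nat y := by
  funext i' j'; simp [State.setNat, h]

@[simp] theorem State.setNat_real (s : State) (x i j v : ℕ) :
    (s.setNat x i j v).real = s.real := rfl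

theorem State.setReal_real_same (s : State) (x i j : ℕ) (v : ℝ) :
    (s.setReal x i j v).real x = fun i' j' => if i' = i ∧ j' = j then v else s.real x i' j' := by
  simp [State.setReal]

theorem State.setReal_real_of_ne (s : State) {x y : ℕ} (i j : ℕ) (v : ℝ) (h : y ≠ x) :
    (s.setReal x i j v).real y = s.real y := by
  funext i' j'; simp [State.setReal, h]

@[simp] theorem State.setReal_nat (s : State) (x i j : ℕ) (v : ℝ) :
    (s.setReal x i j v).nat = s.nat := rfl

/-- Keeps specifications local: facts about arrays that a program never assigns to are carried
across it by evaluating a Boolean, instead of being repeated in every postcondition. -/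
theorem Exec.frame {p : Program} {s s' : State} {T : ℕ} (h : Exec p s s' T) : Frame p s s' := by
  induction h with
  | skip s => exact Frame.rfl _ _
  | setNat s x i j e =>
    refine ⟨fun y hy => ?_, fun _ _ => rfl⟩
    exact State.setNat_nat_of_ne _ _ _ _ (by simpa [Program.writesNat] using hy)
  | setReal s x i j e =>
    refine ⟨fun _ _ => rfl, fun y hy => ?_⟩
    exact State.setReal_real_of_ne _ _ _ _ (by simpa [Program.writesReal] using hy)
  | seq _ _ ih ih' =>
    refine ⟨fun x hx => ?_, fun x hx => ?_⟩
    · simp only [Program.writesNat, Bool.or_eq_false_iff] at hx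
      rw [ih'.nat x hx.2, ih.nat x hx.1]
    · simp only [Program.writesReal, Bool.or_eq_false_iff] at hx
      rw [ih'.real x hx.2, ih.real x hx.1]
  | iteTrue _ _ ih =>
    refine ⟨fun x hx => ih.nat x ?_, fun x hx => ih.real x ?_⟩
    · simp only [Program.writesNat, Bool.or_eq_false_iff] at hx; exact hx.1
    · simp only [Program.writesReal, Bool.or_eq_false_iff] at hx; exact hx.1
  | iteFalse _ _ ih =>
    refine ⟨fun x hx => ih.nat x ?_, fun x hx => ih.real x ?_⟩
    · simp only [Program.writesNat, Bool.or_eq_false_iff] at hx; exact hx.2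
    · simp only [Program.writesReal, Bool.or_eq_false_iff] at hx; exact hx.2
  | loopDone _ => exact Frame.rfl _ _
  | loopStep _ _ _ ih ih' =>
    exact Frame.trans ⟨fun x hx => ih.nat x hx, fun x hx => ih.real x hx⟩ ih'

theorem Run.mono {p : Program} {s : State} {T T' : ℕ} {Q Q' : State → Prop} (h : Run p s T Q)
    (hT : T ≤ T') (hQ : ∀ s', Frame p s s' → Q s' → Q' s') : Run p s T' Q' := by
  obtain ⟨s', t, e, ht, hq⟩ := h
  exact ⟨s', t, e, ht.trans hT, hQ s' e.frame hq⟩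

theorem Run.setNat {s : State} {x : ℕ} {i j e : NExp} {Q : State → Prop}
    (h : Q (s.setNat x (i.eval s) (j.eval s) (e.eval s))) : Run (.setNat x i j e) s 1 Q :=
  ⟨_, _, Exec.setNat s x i j e, le_rfl, h⟩

theorem Run.setReal {s : State} {x : ℕ} {i j : NExp} {e : RExp} {Q : State → Prop}
    (h : Q (s.setReal x (i.eval s) (j.eval s) (e.eval s))) : Run (.setReal x i j e) s 1 Q :=
  ⟨_, _, Exec.setReal s x i j e, le_rfl, h⟩

theorem Run.skip {s : State} {Q : State → Prop} (h : Q s) : Run .skip s 1 Q :=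
  ⟨_, _, Exec.skip s, le_rfl, h⟩

theorem Run.seq {p q : Program} {s : State} {T T' : ℕ} {Q R : State → Prop} (h : Run p s T R)
    (h' : ∀ s', Frame p s s' → R s' → Run q s' T' Q) : Run (.seq p q) s (T + T') Q := by
  obtain ⟨s', t, e, ht, hr⟩ := h
  obtain ⟨s'', t', e', ht', hq⟩ := h' s' e.frame hr
  exact ⟨s'', _, e.seq e', add_le_add ht ht', hq⟩

theorem Run.setNat_seq {q : Program} {s : State} {x : ℕ} {i j e : NExp} {T : ℕ}
    {Q : State → Prop} (h : Run q (s.setNat x (i.eval s) (j.eval s) (e.eval s)) T Q) :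
    Run (.seq (.setNat x i j e) q) s (T + 1) Q := by
  obtain ⟨s'', t', e', ht', hq⟩ := h
  exact ⟨s'', _, (Exec.setNat s x i j e).seq e', by omega, hq⟩

theorem Run.setReal_seq {q : Program} {s : State} {x : ℕ} {i j : NExp} {e : RExp} {T : ℕ}
    {Q : State → Prop} (h : Run q (s.setReal x (i.eval s) (j.eval s) (e.eval s)) T Q) :
    Run (.seq (.setReal x i j e) q) s (T + 1) Q := by
  obtain ⟨s'', t', e', ht', hq⟩ := h
  exact ⟨s'', _, (Exec.setReal s x i j e).seq e', by omega, hq⟩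

theorem Run.ite {b : Test} {p q : Program} {s : State} {T : ℕ} {Q : State → Prop}
    (h : b.eval s → Run p s T Q) (h' : ¬ b.eval s → Run q s T Q) :
    Run (.ite b p q) s (T + 1) Q := by
  by_cases hb : b.eval s
  · obtain ⟨s', t, e, ht, hq⟩ := h hb
    exact ⟨s', _, e.iteTrue hb, by omega, hq⟩
  · obtain ⟨s', t, e, ht, hq⟩ := h' hb
    exact ⟨s', _, e.iteFalse hb, by omega, hq⟩

/-- The hypotheses prescribe the exact number `N` of iterations, so termination and the time bound
come out together. -/
theorem Run.loop {b : Test} {p : Program} {s : State} {T N : ℕ} (Inv : ℕ → State → Prop)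
    (h0 : Inv 0 s)
    (hstep : ∀ k < N, ∀ s', Frame p s s' → Inv k s' → b.eval s' ∧ Run p s' T (Inv (k + 1)))
    (hend : ∀ s', Frame p s s' → Inv N s' → ¬ b.eval s') :
    Run (.loop b p) s (N * (T + 1) + 1) (Inv N) := by
  have key : ∀ m k, k + m = N → ∀ s', Frame p s s' → Inv k s' →
      Run (.loop b p) s' (m * (T + 1) + 1) (Inv N) := by
    intro m
    induction m with
    | zero =>
      intro k hk s' hf hi
      obtain rfl : k = N := by omega
      exact ⟨s', 1, Exec.loopDone (hend s' hf hi), by omega, hi⟩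
    | succ m ih =>
      intro k hk s' hf hi
      obtain ⟨hb, s'', t, e, ht, hi'⟩ := hstep k (by omega) s' hf hi
      obtain ⟨s3, t', e', ht', hq⟩ := ih (k + 1) (by omega) s'' (hf.trans e.frame) hi'
      refine ⟨s3, _, Exec.loopStep hb e e', ?_, hq⟩
      rw [Nat.add_mul]; omega
  exact key N 0 (by omega) s (Frame.rfl _ _) h0

/-- The variable with the name `x`, that is, the first cell of the array `x`. -/
abbrev NExp.var (x : ℕ) : NExp := .read x (.const 0) (.const 0)

/-- The real variable with the name `x`. -/
abbrev RExp.var (x : ℕ) : RExp := .read x (.const 0) (.const 0)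

/-- Assignment to a variable. -/
abbrev Program.setVar (x : ℕ) (e : NExp) : Program := .setNat x (.const 0) (.const 0) e

/-- Assignment to a real variable. -/
abbrev Program.setRVar (x : ℕ) (e : RExp) : Program := .setReal x (.const 0) (.const 0) e

/-- Run the program `p` for the values `0, …, b - 1` of the variable `i`. -/
def Program.forLoop (i : ℕ) (b : NExp) (p : Program) : Program :=
  .seq (.setVar i (.const 0))
    (.loop (.natLe (.add (.var i) (.const 1)) b)
      (.seq p (.setVar i (.add (.var i) (.const 1)))))

/-- `hInv` makes the invariant independent of the counter, so that it survives the increment; the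
counter's value is supplied to `hstep` separately. The bound is re-evaluated at every test, hence
`hb`. -/
theorem Run.forLoop {i : ℕ} {b : NExp} {p : Program} {s : State} {T : ℕ} (N : ℕ)
    (Inv : ℕ → State → Prop) (hi : p.writesNat i = false)
    (hb : ∀ s', Frame (.forLoop i b p) s s' → b.eval s' = N)
    (hInv : ∀ k v s', Inv k s' → Inv k (s'.setNat i 0 0 v))
    (h0 : Inv 0 s)
    (hstep : ∀ k < N, ∀ s', Frame (.forLoop i b p) s s' → s'.nat i 0 0 = k → Inv k s' →
      Run p s' T (Inv (k + 1))) :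
    Run (.forLoop i b p) s (N * (T + 2) + 2) (Inv N) := by
  have hset : ∀ s' v, Frame (.forLoop i b p) s' (s'.setNat i 0 0 v) := fun s' v =>
    ⟨fun y hy => State.setNat_nat_of_ne _ _ _ _ (by
      simp [Program.forLoop, Program.writesNat] at hy; exact hy.1), fun _ _ => rfl⟩
  have hsub : ∀ s' s'', Frame (.seq p (.setVar i (.add (.var i) (.const 1)))) s' s'' →
      Frame (.forLoop i b p) s' s'' := by
    intro s' s'' h
    refine ⟨fun x hx => h.nat x ?_, fun x hx => h.real x ?_⟩
    · simp [Program.forLoop, Program.writesNat] at hx ⊢; tauto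
    · simp [Program.forLoop, Program.writesReal] at hx ⊢; tauto
  have := Run.setNat_seq (x := i) (i := .const 0) (j := .const 0) (e := .const 0) (s := s)
    (Run.loop (b := .natLe (.add (.var i) (.const 1)) b) (N := N) (T := T + 1)
      (p := .seq p (.setVar i (.add (.var i) (.const 1))))
      (fun k s' => Inv k s' ∧ s'.nat i 0 0 = k) ⟨hInv _ _ _ h0, by
        simp [State.setNat, NExp.eval]⟩ ?_ ?_)
  · refine Run.mono this (by ring_nf; omega) (fun s' _ h => h.1)
  · rintro k hk s' hf ⟨h1, h2⟩
    have hf' := (hset s _).trans (hsub _ _ hf)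
    refine ⟨?_, Run.seq (hstep k hk s' hf' h2 h1) fun s'' hf'' h'' => Run.setNat ⟨hInv _ _ _ h'', ?_⟩⟩
    · simp only [Test.eval, NExp.eval, hb s' hf', h2]; omega
    · have := hf''.nat i hi
      simp [State.setNat, NExp.eval, this, h2]
  · rintro s' hf ⟨h1, h2⟩
    have hf' := (hset s _).trans (hsub _ _ hf)
    simp only [Test.eval, NExp.eval, hb s' hf', h2]; omega

/-! ### Renaming of arrays -/

def NExp.rename (f : ℕ → ℕ) : NExp → NExp
  | .const c => .const c
  | .read x i j => .read (f x) (i.rename f) (j.rename f)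
  | .add a b => .add (a.rename f) (b.rename f)
  | .sub a b => .sub (a.rename f) (b.rename f)

def RExp.rename (f g : ℕ → ℕ) : RExp → RExp
  | .const c => .const c
  | .read x i j => .read (g x) (i.rename f) (j.rename f)
  | .add a b => .add (a.rename f g) (b.rename f g)
  | .sub a b => .sub (a.rename f g) (b.rename f g)

def Test.rename (f g : ℕ → ℕ) : Test → Test
  | .natLe a b => .natLe (a.rename f) (b.rename f)
  | .realLe a b => .realLe (a.rename f g) (b.rename f g)
  | .not b => .not (b.rename f g)
  | .and b c => .and (b.rename f g) (c.rename f g)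

/-- Replace the names of the natural-number arrays by means of `f` and those of the real arrays by
means of `g`. -/
def Program.rename (f g : ℕ → ℕ) : Program → Program
  | .skip => .skip
  | .setNat x i j e => .setNat (f x) (i.rename f) (j.rename f) (e.rename f)
  | .setReal x i j e => .setReal (g x) (i.rename f) (j.rename f) (e.rename f g)
  | .seq p q => .seq (p.rename f g) (q.rename f g)
  | .ite b p q => .ite (b.rename f g) (p.rename f g) (q.rename f g)
  | .loop b p => .loop (b.rename f g) (p.rename f g)

/-- The part of the memory that a renamed program can access. -/
def State.pull (f g : ℕ → ℕ) (s : State) : State := ⟨fun x => s.nat (f x), fun x => s.real (g x)⟩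

theorem NExp.eval_rename (f g : ℕ → ℕ) (s : State) (e : NExp) :
    (e.rename f).eval s = e.eval (s.pull f g) := by
  induction e with
  | const c => rfl
  | read x i j hi hj => simp [NExp.rename, NExp.eval, hi, hj, State.pull]
  | add a b ha hb => simp [NExp.rename, NExp.eval, ha, hb]
  | sub a b ha hb => simp [NExp.rename, NExp.eval, ha, hb]

theorem RExp.eval_rename (f g : ℕ → ℕ) (s : State) (e : RExp) :
    (e.rename f g).eval s = e.eval (s.pull f g) := by
  induction e with
  | const c => rfl
  | read x i j => simp [RExp.rename, RExp.eval, NExp.eval_rename f g, State.pull]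
  | add a b ha hb => simp [RExp.rename, RExp.eval, ha, hb]
  | sub a b ha hb => simp [RExp.rename, RExp.eval, ha, hb]

theorem Test.eval_rename (f g : ℕ → ℕ) (s : State) (b : Test) :
    (b.rename f g).eval s ↔ b.eval (s.pull f g) := by
  induction b with
  | natLe a b => simp [Test.rename, Test.eval, NExp.eval_rename f g]
  | realLe a b => simp [Test.rename, Test.eval, RExp.eval_rename f g]
  | not b hb => simp [Test.rename, Test.eval, hb]
  | and b c hb hc => simp [Test.rename, Test.eval, hb, hc]

theorem Program.writesNat_rename {f g : ℕ → ℕ} {x : ℕ} (hx : x ∉ Set.range f) (p : Program) :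
    (p.rename f g).writesNat x = false := by
  induction p with
  | setNat y i j e =>
    simp only [Program.rename, Program.writesNat, beq_eq_false_iff_ne]
    rintro rfl; exact hx ⟨y, rfl⟩
  | _ => simp_all [Program.rename, Program.writesNat]

theorem Program.writesReal_rename {f g : ℕ → ℕ} {x : ℕ} (hx : x ∉ Set.range g) (p : Program) :
    (p.rename f g).writesReal x = false := by
  induction p with
  | setReal y i j e =>
    simp only [Program.rename, Program.writesReal, beq_eq_false_iff_ne]
    rintro rfl; exact hx ⟨y, rfl⟩
  | _ => simp_all [Program.rename, Program.writesReal]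

/-- Injectivity keeps writes to different arrays from colliding. The memory outside the ranges of
`f` and `g` is arbitrary, which allows the program to run as a subroutine inside a larger memory. -/
theorem Exec.rename {f g : ℕ → ℕ} (hf : f.Injective) (hg : g.Injective) {p : Program}
    {s s' : State} {T : ℕ} (h : Exec p s s' T) :
    ∀ S : State, S.pull f g = s → ∃ S', Exec (p.rename f g) S S' T ∧ S'.pull f g = s' := by
  induction h with
  | skip s => exact fun S hS => ⟨S, Exec.skip S, hS⟩
  | setNat s x i j e =>
    rintro S rfl
    refine ⟨_, Exec.setNat S _ _ _ _, ?_⟩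
    simp only [NExp.eval_rename f g]
    simp only [State.pull, State.setNat, hf.eq_iff]
    congr!
  | setReal s x i j e =>
    rintro S rfl
    refine ⟨_, Exec.setReal S _ _ _ _, ?_⟩
    simp only [NExp.eval_rename f g, RExp.eval_rename f g]
    simp only [State.pull, State.setReal, hg.eq_iff]
    congr!
  | seq _ _ ih ih' =>
    intro S hS
    obtain ⟨S', e, hS'⟩ := ih S hS
    obtain ⟨S'', e', hS''⟩ := ih' S' hS'
    exact ⟨S'', e.seq e', hS''⟩
  | iteTrue hb _ ih =>
    rintro S rfl
    obtain ⟨S', e, hS'⟩ := ih S rfl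
    exact ⟨S', e.iteTrue ((Test.eval_rename f g S _).2 hb), hS'⟩
  | iteFalse hb _ ih =>
    rintro S rfl
    obtain ⟨S', e, hS'⟩ := ih S rfl
    exact ⟨S', e.iteFalse (fun h => hb ((Test.eval_rename f g S _).1 h)), hS'⟩
  | loopDone hb =>
    rintro S rfl
    exact ⟨S, Exec.loopDone (fun h => hb ((Test.eval_rename f g S _).1 h)), rfl⟩
  | loopStep hb _ _ ih ih' =>
    rintro S rfl
    obtain ⟨S', e, hS'⟩ := ih S rfl
    obtain ⟨S'', e', hS''⟩ := ih' S' hS'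
    exact ⟨S'', Exec.loopStep ((Test.eval_rename f g S _).2 hb) e e', hS''⟩

/-! ### The flowshop instance of an integral semimetric -/

/-- Climb slowly from `0` to `F` during the first `P` steps, and descend during the next `P`. -/
def wave (P F s : ℕ) : ℕ := min F s - min F (s - P)

/-- The coordinates of job `x = (a * P + b) * n + u`, which stands for vertex `u` of copy `(a, b)` of
the semimetric `w`: the distances of `u` to all vertices, and its distance to vertex `0` at the two
places that are determined by the copy. -/
def coord (n P : ℕ) (w : ℕ → ℕ → ℕ) (x q : ℕ) : ℕ :=
  if q < n then w (x % n) q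
  else if q = n + x / n / P ∨ q = n + P + x / n % P then w (x % n) 0 else 0

/-- A job visits its coordinates one after the other. -/
def level (n P : ℕ) (w : ℕ → ℕ → ℕ) (x k : ℕ) : ℕ :=
  wave P (coord n P w x (k / (2 * P))) (k % (2 * P))

/-- The 1 is added first, so truncated subtraction loses nothing: a wave drops by at most 1 per
step. -/
def procTime (n P : ℕ) (w : ℕ → ℕ → ℕ) (x k : ℕ) : ℕ :=
  1 + wave P (coord n P w x (k / (2 * P))) (k % (2 * P) + 1) -
    wave P (coord n P w x (k / (2 * P))) (k % (2 * P))

/-- `w` is an integral semimetric on `{0, …, n - 1}` with values at most `P` for which all distances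
from vertex `0` vanish. -/
structure IsWeight (n P : ℕ) (w : ℕ → ℕ → ℕ) : Prop where
  self : ∀ u < n, w u u = 0
  zero : ∀ v < n, w 0 v = 0
  triangle : ∀ u < n, ∀ v < n, ∀ x < n, w u x ≤ w u v + w v x
  le : ∀ u < n, ∀ v < n, w u v ≤ P

/-- The flowshop instance that consists of `P * P` copies of the semimetric `w`. -/
abbrev flow (n P : ℕ) (hn : 0 < n) (hP : 0 < P) (w : ℕ → ℕ → ℕ) : NWFS where
  jobs := P * P * n
  machines := (n + 2 * P) * (2 * P)
  jobs_pos := by positivity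
  machines_pos := by positivity
  time x k := procTime n P w x k

/-! ### Delays as the largest excess between coordinate vectors -/

section Delays

variable {n P : ℕ} {w : ℕ → ℕ → ℕ}

theorem coord_le (hn : 0 < n) (hw : IsWeight n P w) (x q : ℕ) : coord n P w x q ≤ P := by
  have hx := Nat.mod_lt x hn
  unfold coord
  split_ifs with h
  · exact hw.le _ hx _ h
  · exact hw.le _ hx _ hn
  · exact Nat.zero_le _

/-- At the end of a block of `2 * P` machines the level switches to the next coordinate; this is
consistent because a wave of height at most `P` is back at 0 after `2 * P` steps. -/
theorem procTime_add_level (hP : 0 < P) (hn : 0 < n) (hw : IsWeight n P w) (x k : ℕ) :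
    procTime n P w x k + level n P w x k = 1 + level n P w x (k + 1) := by
  have hF := coord_le hn hw x (k / (2 * P))
  have hs := Nat.mod_lt k (show 0 < 2 * P by omega)
  have hk := Nat.div_add_mod k (2 * P)
  unfold procTime level
  set s := k % (2 * P) with hsd
  set q := k / (2 * P) with hqd
  by_cases h : s + 1 < 2 * P
  · have := (Nat.div_mod_unique (a := k + 1) (b := 2 * P) (c := s + 1) (d := q) (by omega)).2
      ⟨by omega, h⟩
    rw [this.1, this.2]
    simp only [wave]
    omega
  · have := (Nat.div_mod_unique (a := k + 1) (b := 2 * P) (c := 0) (d := q + 1) (by omega)).2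
      ⟨by rw [mul_add]; omega, by omega⟩
    rw [this.1, this.2]
    simp only [wave]
    omega

theorem procTime_le (x k : ℕ) : procTime n P w x k ≤ 2 := by
  simp only [procTime, wave]
  omega

theorem sum_procTime (hP : 0 < P) (hn : 0 < n) (hw : IsWeight n P w) (x m : ℕ) :
    ∑ k ∈ Finset.range m, procTime n P w x k = m + level n P w x m := by
  induction m with
  | zero => simp [level, wave]
  | succ m ih =>
    rw [Finset.sum_range_succ, ih]
    have := procTime_add_level hP hn hw x m
    omega

theorem sum_Iic_fin {M : ℕ} (f : ℕ → ℤ) (q : Fin M) :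
    ∑ k ∈ Finset.Iic q, f k = ∑ k ∈ Finset.range (q + 1), f k := by
  rw [Nat.range_succ_eq_Iic, ← Fin.map_valEmbedding_Iic, Finset.sum_map]
  rfl

theorem sum_Iio_fin {M : ℕ} (f : ℕ → ℤ) (q : Fin M) :
    ∑ k ∈ Finset.Iio q, f k = ∑ k ∈ Finset.range q, f k := by
  rw [← Nat.Iio_eq_range, ← Fin.map_valEmbedding_Iio, Finset.sum_map]
  rfl

variable (hn : 0 < n) (hP : 0 < P)

theorem flow_delay_term (hw : IsWeight n P w) (x y : Fin (flow n P hn hP w).jobs)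
    (q : Fin (flow n P hn hP w).machines) :
    ∑ k ∈ Finset.Iic q, ((flow n P hn hP w).time x k : ℤ) -
      ∑ k ∈ Finset.Iio q, ((flow n P hn hP w).time y k : ℤ) =
    1 + level n P w x (q + 1) - level n P w y q := by
  simp only [flow]
  rw [sum_Iic_fin (fun k => (procTime n P w x k : ℤ)),
    sum_Iio_fin (fun k => (procTime n P w y k : ℤ)), ← Nat.cast_sum, ← Nat.cast_sum,
    sum_procTime hP hn hw, sum_procTime hP hn hw]
  push_cast
  ring

/-- A wave grows with its height, and by no more than the height does, so a coordinatewise bound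
passes to the levels at a common machine. The `2` is the largest processing time, which accounts for
comparing `q + 1` with `q`. -/
theorem flow_delay_le (hw : IsWeight n P w) (x y : Fin (flow n P hn hP w).jobs) (B : ℕ)
    (h : ∀ q, coord n P w x q ≤ coord n P w y q + B) :
    (flow n P hn hP w).delay x y ≤ B + 2 := by
  refine Finset.sup'_le _ _ fun q _ => ?_
  rw [flow_delay_term hn hP hw]
  have h1 := procTime_add_level hP hn hw x q
  have h2 := procTime_le (n := n) (P := P) (w := w) x q
  have h3 : level n P w x q ≤ level n P w y q + B := by
    have := h (q / (2 * P))
    have := coord_le hn hw x (q / (2 * P))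
    have := coord_le hn hw y (q / (2 * P))
    simp only [level, wave]
    omega
  omega

theorem le_flow_delay (hw : IsWeight n P w) (x y : Fin (flow n P hn hP w).jobs) {q : ℕ}
    (hq : q < n + 2 * P) :
    (coord n P w x q : ℤ) - coord n P w y q ≤ (flow n P hn hP w).delay x y := by
  -- The machine at the peak of block `q`: after it the wave of `x` has its full height, while
  -- before it that of `y` is at most its height.
  have hk : q * (2 * P) + (P - 1) < (n + 2 * P) * (2 * P) := by
    calc q * (2 * P) + (P - 1) < (q + 1) * (2 * P) := by rw [add_mul]; omega
      _ ≤ _ := Nat.mul_le_mul_right _ hq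
  refine le_trans ?_ (Finset.le_sup' _ (Finset.mem_univ ⟨q * (2 * P) + (P - 1), hk⟩))
  rw [flow_delay_term hn hP hw]
  have e1 := (Nat.div_mod_unique (a := q * (2 * P) + (P - 1)) (b := 2 * P) (c := P - 1) (d := q)
    (by omega)).2 ⟨by ring, by omega⟩
  have e2 := (Nat.div_mod_unique (a := q * (2 * P) + (P - 1) + 1) (b := 2 * P) (c := P) (d := q)
    (by omega)).2 ⟨by rw [mul_comm]; omega, by omega⟩
  have h1 := coord_le hn hw x q
  simp only [level, e1.1, e1.2, e2.1, e2.2, wave]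
  omega

/-- Equal copies share their marker positions, so every nonzero coordinate of `x` is a distance that
the triangle inequality compares with the same coordinate of `y`. -/
theorem flow_delay_le_of_copy_eq (hw : IsWeight n P w) (x y : Fin (flow n P hn hP w).jobs)
    (h : (x : ℕ) / n = y / n) :
    (flow n P hn hP w).delay x y ≤ w (x % n) (y % n) + 2 := by
  refine flow_delay_le hn hP hw x y _ fun q => ?_
  have hx := Nat.mod_lt x hn
  have hy := Nat.mod_lt y hn
  simp only [coord, h]
  split_ifs with h1
  · rw [add_comm]; exact hw.triangle _ hx _ hy _ h1
  · rw [add_comm]; exact hw.triangle _ hx _ hy _ hn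
  · exact Nat.zero_le _

/-- No coordinate of `x` exceeds the distance to vertex 0, because leaving vertex 0 is free. -/
theorem flow_delay_le_dist_zero (hw : IsWeight n P w) (x y : Fin (flow n P hn hP w).jobs) :
    (flow n P hn hP w).delay x y ≤ w (x % n) 0 + 2 := by
  refine flow_delay_le hn hP hw x y _ fun q => ?_
  have hx := Nat.mod_lt x hn
  refine le_trans ?_ (Nat.le_add_left _ _)
  unfold coord
  split_ifs with h1
  · simpa [hw.zero q h1] using hw.triangle _ hx _ hn _ h1
  · exact le_rfl
  · exact Nat.zero_le _

/-- At the coordinate belonging to its own vertex, `y` has the value 0. The copies play no role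
here. -/
theorem le_flow_delay_of_copy_eq (hw : IsWeight n P w) (x y : Fin (flow n P hn hP w).jobs) :
    (w (x % n) (y % n) : ℤ) ≤ (flow n P hn hP w).delay x y := by
  have hy := Nat.mod_lt y hn
  have := le_flow_delay hn hP hw x y (q := y % n) (by omega)
  simpa [coord, hy, hw.self _ hy] using this

/-- Different copies differ in one of their two base-`P` digits; at the marker of `x` for that
digit, `y` has the value 0. -/
theorem le_flow_delay_of_copy_ne (hw : IsWeight n P w) (x y : Fin (flow n P hn hP w).jobs)
    (h : (x : ℕ) / n ≠ y / n) :
    (w (x % n) 0 : ℤ) ≤ (flow n P hn hP w).delay x y := by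
  have hc : ∀ z : Fin (flow n P hn hP w).jobs, (z : ℕ) / n / P < P := fun z => by
    rw [Nat.div_lt_iff_lt_mul hP, Nat.div_lt_iff_lt_mul hn]
    exact z.2
  have hxa : (x : ℕ) / n / P < P := hc x
  have hya : (y : ℕ) / n / P < P := hc y
  have hxb := Nat.mod_lt ((x : ℕ) / n) hP
  have hyb := Nat.mod_lt ((y : ℕ) / n) hP
  by_cases ha : (x : ℕ) / n / P = y / n / P
  · have hb : (x : ℕ) / n % P ≠ y / n % P := fun hb =>
      h (by rw [← Nat.div_add_mod ((x : ℕ) / n) P, ← Nat.div_add_mod ((y : ℕ) / n) P, ha, hb])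
    have := le_flow_delay hn hP hw x y (q := n + P + x / n % P) (by grind)
    rw [coord, coord, if_neg (by grind), if_pos (by grind), if_neg (by grind),
      if_neg (by grind)] at this
    simpa using this
  · have := le_flow_delay hn hP hw x y (q := n + x / n / P) (by grind)
    rw [coord, coord, if_neg (by grind), if_pos (by grind), if_neg (by grind),
      if_neg (by grind)] at this
    simpa using this

/-- The increments telescope to 0 over full blocks, so only the 1 per machine remains. -/
theorem flow_jobLength (hw : IsWeight n P w) (x : Fin (flow n P hn hP w).jobs) :
    (flow n P hn hP w).jobLength x = ((n + 2 * P) * (2 * P) : ℕ) := by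
  have : (flow n P hn hP w).jobLength x = ∑ k : Fin ((n + 2 * P) * (2 * P)), (procTime n P w x k : ℤ) :=
    rfl
  rw [this, Fin.sum_univ_eq_sum_range (fun k => (procTime n P w x k : ℤ)), ← Nat.cast_sum,
    sum_procTime hP hn hw]
  simp [level, wave]

theorem flow_size_le :
    (flow n P hn hP w).size ≤ P * P * n * ((n + 2 * P) * (2 * P) * 3) := by
  have hs : ∀ t ≤ 2, Nat.size t + 1 ≤ 3 := by decide
  have : (flow n P hn hP w).size ≤
      ∑ _x : Fin (P * P * n), ∑ _k : Fin ((n + 2 * P) * (2 * P)), 3 :=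
    Finset.sum_le_sum fun x _ => Finset.sum_le_sum fun k _ => hs _ (procTime_le _ _)
  simpa using this

end Delays

theorem val_finRotate {n : ℕ} (i : Fin n) :
    (finRotate n i : ℕ) = if (i : ℕ) + 1 < n then (i : ℕ) + 1 else 0 := by
  obtain ⟨m, rfl⟩ : ∃ m, n = m + 1 := ⟨n - 1, by have := i.2; omega⟩
  have := i.2
  rw [coe_finRotate]
  simp only [Fin.ext_iff, Fin.val_last]
  split_ifs <;> omega

/-! ### Splitting a job order into tours of the copies -/

section Split

variable {K n : ℕ} (σ : Equiv.Perm (Fin (K * n)))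

/-- The job at position `k`. -/
def jobAt (k : ℕ) : ℕ := if h : k < K * n then σ ⟨k, h⟩ else 0

theorem jobAt_fin (k : Fin (K * n)) : jobAt σ k = σ k := by simp [jobAt]

/-- The number of jobs of copy `c` before position `k`. -/
def copyCount (k c : ℕ) : ℕ := ((Finset.range k).filter fun k' => jobAt σ k' / n = c).card

theorem copyCount_zero (c : ℕ) : copyCount σ 0 c = 0 := by simp [copyCount]

theorem copyCount_succ (k c : ℕ) :
    copyCount σ (k + 1) c = copyCount σ k c + if jobAt σ k / n = c then 1 else 0 := by
  unfold copyCount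
  rw [Finset.range_add_one, Finset.filter_insert]
  split_ifs with h
  · rw [Finset.card_insert_of_notMem (by simp)]
  · rfl

theorem copyCount_mono {k k' : ℕ} (h : k ≤ k') (c : ℕ) : copyCount σ k c ≤ copyCount σ k' c :=
  Finset.card_le_card (Finset.filter_subset_filter _ (Finset.range_mono h))

theorem jobAt_injOn : Set.InjOn (jobAt σ) (Set.Iio (K * n)) := by
  intro k hk k' hk' h
  simp only [Set.mem_Iio] at hk hk'
  simpa [jobAt, hk, hk', Fin.val_inj] using h

theorem copyCount_le (hn : 0 < n) {k : ℕ} (hk : k ≤ K * n) (c : ℕ) : copyCount σ k c ≤ n := by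
  refine (Finset.card_le_card_of_injOn (t := Finset.range n) (fun k' => jobAt σ k' % n)
    (fun k' _ => by simpa using Nat.mod_lt _ hn) ?_).trans_eq (Finset.card_range n)
  intro a ha b hb hab
  simp only [Finset.coe_filter, Finset.mem_range, Set.mem_ofPred_eq] at ha hb hab
  refine jobAt_injOn σ (by simp; omega) (by simp; omega) ?_
  rw [← Nat.div_add_mod (jobAt σ a) n, ← Nat.div_add_mod (jobAt σ b) n, ha.2, hb.2, hab]

theorem copyCount_lt (hn : 0 < n) {k : ℕ} (hk : k < K * n) :
    copyCount σ k (jobAt σ k / n) < n := by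
  have := copyCount_le σ hn (Nat.succ_le_of_lt hk) (jobAt σ k / n)
  rw [copyCount_succ] at this
  simpa using this

/-- Passing a job raises the count of its copy, so a later job of the same copy has a strictly
larger rank. -/
theorem copyCount_injOn {k k' : ℕ} (h : jobAt σ k / n = jobAt σ k' / n)
    (h' : copyCount σ k (jobAt σ k / n) = copyCount σ k' (jobAt σ k' / n)) : k = k' := by
  have aux : ∀ a b : ℕ, a < b → jobAt σ a / n = jobAt σ b / n →
      copyCount σ a (jobAt σ a / n) ≠ copyCount σ b (jobAt σ b / n) := by
    intro a b hab e
    have := copyCount_mono σ (Nat.succ_le_of_lt hab) (jobAt σ a / n)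
    rw [copyCount_succ, if_pos rfl, e] at this
    rw [e]
    omega
  rcases lt_trichotomy k k' with hlt | rfl | hlt
  · exact absurd h' (aux _ _ hlt h)
  · rfl
  · exact absurd h'.symm (aux _ _ hlt h.symm)

variable (hn : 0 < n)

/-- A position in the job order corresponds to a copy and a position in the tour of that copy. -/
noncomputable def copyPosition : Fin (K * n) ≃ Fin K × Fin n :=
  Equiv.ofBijective
    (fun k => (⟨jobAt σ k / n, by
      rw [Nat.div_lt_iff_lt_mul hn, jobAt_fin]; exact (σ k).2⟩,
      ⟨copyCount σ k (jobAt σ k / n), copyCount_lt σ hn k.2⟩))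
    ((Fintype.bijective_iff_injective_and_card _).2 ⟨fun k k' h => by
      simp only [Prod.mk.injEq, Fin.mk.injEq] at h
      exact Fin.ext (copyCount_injOn σ h.1 h.2), by simp⟩)

theorem copyPosition_fst (k : Fin (K * n)) : ((copyPosition σ hn k).1 : ℕ) = σ k / n := by
  simp [copyPosition, jobAt_fin]

theorem copyPosition_snd (k : Fin (K * n)) :
    ((copyPosition σ hn k).2 : ℕ) = copyCount σ k (σ k / n) := by
  simp [copyPosition, jobAt_fin]

/-- The order of the vertices of copy `c` in the job order. -/
noncomputable def copyTour (c : Fin K) : Equiv.Perm (Fin n) :=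
  Equiv.ofBijective
    (fun i => (⟨σ ((copyPosition σ hn).symm (c, i)) % n, Nat.mod_lt _ hn⟩ : Fin n))
    (Finite.injective_iff_bijective.1 fun i i' h => by
      simp only [Fin.mk.injEq] at h
      have e : ∀ i, ((σ ((copyPosition σ hn).symm (c, i)) : Fin (K * n)) : ℕ) / n = c := fun i => by
        rw [← copyPosition_fst σ hn]; simp
      have : σ ((copyPosition σ hn).symm (c, i)) = σ ((copyPosition σ hn).symm (c, i')) := by
        apply Fin.ext
        rw [← Nat.div_add_mod (σ ((copyPosition σ hn).symm (c, i)) : ℕ) n,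
          ← Nat.div_add_mod (σ ((copyPosition σ hn).symm (c, i')) : ℕ) n, e, e, h]
      simpa using this)

theorem copyTour_copyPosition (k : Fin (K * n)) :
    (copyTour σ hn (copyPosition σ hn k).1 (copyPosition σ hn k).2 : ℕ) = σ k % n := by
  simp [copyTour]

/-- No other job lies between adjacent positions, so the ranks within the copy differ by exactly
one. -/
theorem copyTour_finRotate (k : Fin (K * n)) (hk : (k : ℕ) + 1 < K * n)
    (h : (σ k : ℕ) / n = σ ⟨k + 1, hk⟩ / n) :
    (copyTour σ hn (copyPosition σ hn k).1 (finRotate n (copyPosition σ hn k).2) : ℕ) =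
      σ ⟨k + 1, hk⟩ % n := by
  rw [← copyTour_copyPosition σ hn]
  have h1 : (copyPosition σ hn ⟨k + 1, hk⟩).1 = (copyPosition σ hn k).1 := by
    apply Fin.ext
    rw [copyPosition_fst, copyPosition_fst, h]
  have h2 : ((copyPosition σ hn ⟨k + 1, hk⟩).2 : ℕ) = (copyPosition σ hn k).2 + 1 := by
    rw [copyPosition_snd, copyPosition_snd, ← h]
    simp only
    rw [copyCount_succ, jobAt_fin, if_pos rfl]
  have h3 : finRotate n (copyPosition σ hn k).2 = (copyPosition σ hn ⟨k + 1, hk⟩).2 := by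
    apply Fin.ext
    -- The next rank is itself below `n`, so the rotation does not wrap around.
    rw [val_finRotate, if_pos (h2 ▸ Fin.is_lt _), h2]
  rw [h1, h3]

end Split

/-- The length of the cyclic vertex order `τ` with respect to integral weights. -/
def weightLength {n : ℕ} (w : ℕ → ℕ → ℕ) (τ : Equiv.Perm (Fin n)) : ℕ :=
  ∑ i : Fin n, w (τ i) (τ (finRotate n i))

/-! ### Makespan against the total weight of the tours of the copies -/

section Makespan

variable {n P : ℕ} {w : ℕ → ℕ → ℕ} (hn : 0 < n) (hP : 0 < P)

/-- Each tour arc is charged to the position of its tail `u`. If the next job is in the same copy,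
it is the head of the arc; otherwise the delay is at least w(u, 0), which dominates every arc out of
`u`. The last arc is paid for by the length of the last job, which is at least `P`. -/
theorem sum_weightLength_copyTour_le (hw : IsWeight n P w)
    (σ : Equiv.Perm (Fin (flow n P hn hP w).jobs)) :
    ((∑ c : Fin (P * P), weightLength w (copyTour (K := P * P) σ hn c) : ℕ) : ℤ) ≤
      (flow n P hn hP w).makespan σ := by
  have h0 : ∀ u < n, ∀ v < n, w u v ≤ w u 0 := fun u hu v hv => by
    simpa [hw.zero v hv] using hw.triangle u hu 0 hn v hv
  unfold weightLength NWFS.makespan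
  rw [← Fintype.sum_prod_type', Nat.cast_sum, ← (copyPosition (K := P * P) σ hn).sum_comp]
  refine Finset.sum_le_sum fun k _ => ?_
  rw [copyTour_copyPosition]
  have hu := Nat.mod_lt (σ k : ℕ) hn
  have hv := (copyTour (K := P * P) σ hn (copyPosition (K := P * P) σ hn k).1
    (finRotate n (copyPosition (K := P * P) σ hn k).2)).2
  split_ifs with h
  · by_cases hc : (σ k : ℕ) / n = σ ⟨k + 1, h⟩ / n
    · have e := copyTour_finRotate (K := P * P) σ hn k h hc
      rw [e]
      exact le_flow_delay_of_copy_eq hn hP hw _ _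
    · refine le_trans ?_ (le_flow_delay_of_copy_ne hn hP hw _ _ hc)
      exact_mod_cast h0 _ hu _ hv
  · rw [flow_jobLength hn hP hw]
    have h1 := hw.le _ hu _ hv
    have h2 : P ≤ (n + 2 * P) * (2 * P) := by nlinarith
    exact_mod_cast h1.trans h2

/-- The job order that processes the copies one after the other, each in the order `ρ`. -/
def repeatOrder (K : ℕ) (ρ : Equiv.Perm (Fin n)) : Equiv.Perm (Fin (K * n)) :=
  (finProdFinEquiv.symm.trans (Equiv.prodCongr (Equiv.refl (Fin K)) ρ)).trans finProdFinEquiv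

theorem repeatOrder_apply (K : ℕ) (ρ : Equiv.Perm (Fin n)) (k : Fin (K * n)) :
    (repeatOrder K ρ k : ℕ) = ρ ⟨k % n, Nat.mod_lt _ hn⟩ + n * (k / n) := by
  simp [repeatOrder, finProdFinEquiv, Fin.divNat, Fin.modNat]

/-- Inside a copy the delays are tour arcs plus at most 2. Since `ρ` starts at vertex 0, the closing
arc weighs w(u, 0), and this also bounds the delay of moving on to the next copy. -/
theorem flow_opt_le (hw : IsWeight n P w) (ρ : Equiv.Perm (Fin n)) (hρ : (ρ ⟨0, hn⟩ : ℕ) = 0) :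
    (flow n P hn hP w).opt ≤
      ((P * P * (weightLength w ρ + 2 * n) + (n + 2 * P) * (2 * P) : ℕ) : ℤ) := by
  refine (Finset.inf'_le _ (Finset.mem_univ (repeatOrder (P * P) ρ))).trans ?_
  have key : ∀ k : Fin (P * P * n),
      (if h : (k : ℕ) + 1 < (flow n P hn hP w).jobs then
        (flow n P hn hP w).delay (repeatOrder (P * P) ρ k) (repeatOrder (P * P) ρ ⟨k + 1, h⟩)
        else (flow n P hn hP w).jobLength (repeatOrder (P * P) ρ k)) ≤
      (w (ρ ⟨k % n, Nat.mod_lt _ hn⟩) (ρ (finRotate n ⟨k % n, Nat.mod_lt _ hn⟩)) + 2 : ℤ) +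
        if (k : ℕ) + 1 = P * P * n then (((n + 2 * P) * (2 * P) : ℕ) : ℤ) else 0 := by
    intro k
    have hk := k.2
    have hmod : ∀ k : Fin (P * P * n),
        (repeatOrder (P * P) ρ k : ℕ) % n = ρ ⟨k % n, Nat.mod_lt _ hn⟩ := fun k => by
      rw [repeatOrder_apply hn, Nat.add_mul_mod_self_left, Nat.mod_eq_of_lt (Fin.is_lt _)]
    have hdiv : ∀ k : Fin (P * P * n), (repeatOrder (P * P) ρ k : ℕ) / n = k / n := fun k => by
      rw [repeatOrder_apply hn, Nat.add_mul_div_left _ _ hn, Nat.div_eq_of_lt (Fin.is_lt _),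
        zero_add]
    have hdm := Nat.div_add_mod (k : ℕ) n
    have hlt := Nat.mod_lt (k : ℕ) hn
    split_ifs with h h' h'
    · exact absurd h' (by simp only at h; omega)
    · rw [add_zero]
      by_cases hc : (k : ℕ) % n + 1 < n
      · have e := (Nat.div_mod_unique (a := (k : ℕ) + 1) (b := n) (c := k % n + 1) (d := k / n)
          hn).2 ⟨by omega, hc⟩
        refine (flow_delay_le_of_copy_eq hn hP hw _ _ ?_).trans ?_
        · rw [hdiv]
          exact (hdiv ⟨k + 1, h⟩ ▸ e.1.symm :)
        · rw [hmod]
          have e' := hmod ⟨k + 1, h⟩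
          rw [e']
          have : finRotate n ⟨k % n, Nat.mod_lt _ hn⟩ = ⟨((⟨k + 1, h⟩ : Fin (P * P * n)) : ℕ) % n,
              Nat.mod_lt _ hn⟩ := by
            apply Fin.ext
            rw [val_finRotate, if_pos hc]
            exact e.2.symm
          rw [this]
      -- Last vertex of a copy: its successor in the tour is vertex 0.
      · refine (flow_delay_le_dist_zero hn hP hw _ _).trans ?_
        rw [hmod]
        have : finRotate n ⟨k % n, Nat.mod_lt _ hn⟩ = ⟨0, hn⟩ := by
          apply Fin.ext
          rw [val_finRotate, if_neg hc]
        rw [this, hρ]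
    · rw [flow_jobLength hn hP hw]
      have : (0 : ℤ) ≤ w (ρ ⟨k % n, Nat.mod_lt _ hn⟩) (ρ (finRotate n ⟨k % n, Nat.mod_lt _ hn⟩)) :=
        Int.natCast_nonneg _
      omega
    · exact absurd h' (by simp only at h; omega)
  refine (Finset.sum_le_sum fun k _ => key k).trans (le_of_eq ?_)
  have hN : 0 < P * P * n := by positivity
  change ∑ k : Fin (P * P * n), _ = _
  rw [Finset.sum_add_distrib]
  have e1 : ∑ k : Fin (P * P * n), (if (k : ℕ) + 1 = P * P * n then
      (((n + 2 * P) * (2 * P) : ℕ) : ℤ) else 0) = ((n + 2 * P) * (2 * P) : ℕ) := by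
    rw [Finset.sum_eq_single (⟨P * P * n - 1, by omega⟩ : Fin (P * P * n))]
    · rw [if_pos (by simp only; omega)]
    · intro k _ hk
      rw [if_neg]
      intro h
      exact hk (Fin.ext (by simp only; omega))
    · simp
  have e2 : ∑ k : Fin (P * P * n),
      (w (ρ ⟨k % n, Nat.mod_lt _ hn⟩) (ρ (finRotate n ⟨k % n, Nat.mod_lt _ hn⟩)) + 2 : ℤ) =
      ((P * P * (weightLength w ρ + 2 * n) : ℕ) : ℤ) := by
    rw [← finProdFinEquiv.sum_comp, Fintype.sum_prod_type]
    have : ∀ (c : Fin (P * P)) (i : Fin n),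
        (⟨(finProdFinEquiv (c, i) : Fin (P * P * n)) % n, Nat.mod_lt _ hn⟩ : Fin n) = i :=
      fun c i => Fin.ext (by simp [finProdFinEquiv, Nat.mod_eq_of_lt i.2])
    simp only [this]
    simp only [weightLength, Finset.sum_add_distrib, Finset.sum_const, Finset.card_univ,
      Fintype.card_fin, nsmul_eq_mul]
    push_cast
    ring
  rw [e1, e2]
  push_cast
  ring

end Makespan

/-! ### Scaling and rounding the arc weights -/

namespace ATSP

variable (G : ATSP)

/-- The arc weights, indexed by natural numbers. -/
noncomputable def dist (u v : ℕ) : ℝ :=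
  if h : u < G.n ∧ v < G.n then G.d ⟨u, h.1⟩ ⟨v, h.2⟩ else 0

theorem dist_self {u : ℕ} (hu : u < G.n) : G.dist u u = 0 := by simp [dist, hu, G.d_self]

theorem dist_triangle {u v x : ℕ} (hu : u < G.n) (hv : v < G.n) (hx : x < G.n) :
    G.dist u x ≤ G.dist u v + G.dist v x := by
  simpa [dist, hu, hv, hx] using G.triangle ⟨u, hu⟩ ⟨v, hv⟩ ⟨x, hx⟩

/-- The arc weights after a shift that does not change the lengths of the tours and makes all arcs
from vertex `0` have weight `0`. -/
noncomputable def shifted (u v : ℕ) : ℝ := G.dist u v + G.dist 0 u - G.dist 0 v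

theorem shifted_self {u : ℕ} (hu : u < G.n) : G.shifted u u = 0 := by
  simp [shifted, G.dist_self hu]

theorem shifted_zero (v : ℕ) : G.shifted 0 v = 0 := by
  simp [shifted, G.dist_self G.n_pos]

theorem shifted_triangle {u v x : ℕ} (hu : u < G.n) (hv : v < G.n) (hx : x < G.n) :
    G.shifted u x ≤ G.shifted u v + G.shifted v x := by
  have := G.dist_triangle hu hv hx
  unfold shifted
  linarith

theorem shifted_nonneg {u v : ℕ} (hu : u < G.n) (hv : v < G.n) : 0 ≤ G.shifted u v := by
  have := G.dist_triangle G.n_pos hu hv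
  unfold shifted
  linarith

theorem shifted_le {u v : ℕ} (hu : u < G.n) (hv : v < G.n) : G.shifted u v ≤ G.shifted u 0 := by
  simpa [G.shifted_zero] using G.shifted_triangle hu G.n_pos hv

/-- The potentials cancel, since tails and heads of the arcs both run once through all vertices. -/
theorem tourLength_eq_sum_shifted (τ : Equiv.Perm (Fin G.n)) :
    G.tourLength τ = ∑ k : Fin G.n, G.shifted (τ k) (τ (finRotate G.n k)) := by
  have h1 := Equiv.sum_comp τ (fun u : Fin G.n => G.dist 0 u)
  have h2 := Equiv.sum_comp ((finRotate G.n).trans τ) (fun u : Fin G.n => G.dist 0 u)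
  simp only [shifted, Finset.sum_sub_distrib, Finset.sum_add_distrib]
  simp only [Equiv.trans_apply] at h2
  rw [h1, h2, add_sub_cancel_right]
  simp [tourLength, dist]

/-- The maximum of the shifted arc weights. -/
noncomputable def diam : ℝ :=
  Finset.univ.sup' (⟨⟨0, G.n_pos⟩, Finset.mem_univ _⟩ : (Finset.univ : Finset (Fin G.n)).Nonempty)
    (fun u => G.shifted u 0)

theorem shifted_le_diam {u v : ℕ} (hu : u < G.n) (hv : v < G.n) : G.shifted u v ≤ G.diam :=
  (G.shifted_le hu hv).trans
    (Finset.le_sup' (fun u : Fin G.n => G.shifted u 0) (Finset.mem_univ ⟨u, hu⟩))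

theorem diam_nonneg : 0 ≤ G.diam :=
  (G.shifted_nonneg G.n_pos G.n_pos).trans (G.shifted_le_diam G.n_pos G.n_pos)

theorem exists_rotate (τ : Equiv.Perm (Fin G.n)) :
    ∃ ρ : Equiv.Perm (Fin G.n), (ρ ⟨0, G.n_pos⟩ : ℕ) = 0 ∧ G.tourLength ρ = G.tourLength τ := by
  obtain ⟨n, hn, d, hd, ht⟩ := G
  obtain ⟨m, rfl⟩ : ∃ m, n = m + 1 := ⟨n - 1, by omega⟩
  -- Shifting the positions by that of vertex 0 brings vertex 0 to the front.
  refine ⟨(Equiv.addRight (τ.symm 0)).trans τ, ?_, ?_⟩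
  · have : (⟨0, hn⟩ : Fin (m + 1)) = 0 := rfl
    simp [this]
  · simp only [tourLength, finRotate_apply, Equiv.trans_apply, Equiv.coe_addRight]
    rw [← Equiv.sum_comp (Equiv.addRight (τ.symm 0)) (fun k => d (τ k) (τ (k + 1)))]
    refine Finset.sum_congr rfl fun k _ => ?_
    simp only [Equiv.coe_addRight]
    rw [add_right_comm]

/-- In a tour starting at 0, the part from any `u` onwards is a path back to 0, which is at least as
long as the direct arc; the arcs before `u` are nonnegative. -/
theorem diam_le_tourLength (τ : Equiv.Perm (Fin G.n)) : G.diam ≤ G.tourLength τ := by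
  obtain ⟨ρ, hρ, e⟩ := G.exists_rotate τ
  rw [← e, G.tourLength_eq_sum_shifted]
  have hn := G.n_pos
  -- The default value 0 at index `n` is the first vertex of `ρ`, so the closing arc fits into a sum
  -- over consecutive indices.
  set r : ℕ → ℕ := fun i => if h : i < G.n then ρ ⟨i, h⟩ else 0 with hr
  have hlt : ∀ i, r i < G.n := fun i => by
    simp only [hr]
    split_ifs
    · exact Fin.is_lt _
    · exact hn
  have hrn : r G.n = 0 := by simp [hr]
  have hsum : ∑ k : Fin G.n, G.shifted (ρ k) (ρ (finRotate G.n k)) =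
      ∑ i ∈ Finset.range G.n, G.shifted (r i) (r (i + 1)) := by
    rw [← Fin.sum_univ_eq_sum_range (fun i => G.shifted (r i) (r (i + 1)))]
    refine Finset.sum_congr rfl fun k _ => ?_
    have h1 : r k = ρ k := by simp [hr]
    have h2 : r (k + 1) = ρ (finRotate G.n k) := by
      by_cases h : (k : ℕ) + 1 < G.n
      · simp only [hr, h, dif_pos]
        congr 2
        apply Fin.ext
        rw [val_finRotate, if_pos h]
      · have : finRotate G.n k = ⟨0, hn⟩ := by
          apply Fin.ext
          rw [val_finRotate, if_neg h]
        rw [this, hρ]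
        simp [hr, h]
    rw [h1, h2]
  rw [hsum]
  refine Finset.sup'_le _ _ fun u _ => ?_
  obtain ⟨j, rfl⟩ := ρ.surjective u
  have h1 : r j = ρ j := by simp [hr]
  have key : ∀ t k, k + t = G.n → G.shifted (r k) 0 ≤
      ∑ i ∈ Finset.Ico k G.n, G.shifted (r i) (r (i + 1)) := by
    intro t
    induction t with
    | zero =>
      rintro k rfl
      rw [hrn]
      simp [G.shifted_zero]
    | succ t ih =>
      intro k hk
      rw [Finset.sum_eq_sum_Ico_succ_bot (by omega)]
      exact (G.shifted_triangle (hlt _) (hlt (k + 1)) hn).trans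
        (by linarith [ih (k + 1) (by omega)])
  rw [← h1]
  refine (key (G.n - j) j (by omega)).trans ?_
  rw [Finset.range_eq_Ico]
  exact Finset.sum_le_sum_of_subset_of_nonneg (Finset.Ico_subset_Ico_left (Nat.zero_le _))
    fun i _ _ => G.shifted_nonneg (hlt _) (hlt _)

theorem diam_le_opt : G.diam ≤ G.opt :=
  Finset.le_inf' _ _ fun τ _ => G.diam_le_tourLength τ

/-- The number of copies in each of the two directions, and the maximum of the rounded weights. -/
noncomputable def scale (ε : ℝ) : ℕ := G.n * ⌈9 / ε⌉₊

/-- The scaled and rounded arc weights. -/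
noncomputable def weight (ε : ℝ) (u v : ℕ) : ℕ := ⌈G.scale ε * G.shifted u v / G.diam⌉₊

variable {ε : ℝ}

theorem scale_pos (hε : 0 < ε) : 0 < G.scale ε :=
  Nat.mul_pos G.n_pos (Nat.ceil_pos.2 (by positivity))

theorem le_scale_mul (hε : 0 < ε) : 9 * G.n ≤ G.scale ε * ε := by
  have h := Nat.le_ceil (9 / ε)
  rw [div_le_iff₀ hε] at h
  unfold scale
  push_cast
  nlinarith [Nat.cast_nonneg (α := ℝ) G.n]

/-- Rounding up preserves the triangle inequality because the ceiling is subadditive. If `diam` is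
0, division by zero makes all weights 0. -/
theorem isWeight (ε : ℝ) : IsWeight G.n (G.scale ε) (G.weight ε) where
  self u hu := by simp [weight, G.shifted_self hu]
  zero v _ := by simp [weight, G.shifted_zero]
  triangle u hu v hv x hx := by
    refine le_trans (Nat.ceil_mono ?_) (Nat.ceil_add_le _ _)
    rw [← add_div, ← mul_add]
    exact div_le_div_of_nonneg_right
      (mul_le_mul_of_nonneg_left (G.shifted_triangle hu hv hx) (Nat.cast_nonneg _)) G.diam_nonneg
  le u hu v hv := by
    refine Nat.ceil_le.2 (div_le_of_le_mul₀ G.diam_nonneg (Nat.cast_nonneg _) ?_)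
    exact mul_le_mul_of_nonneg_left (G.shifted_le_diam hu hv) (Nat.cast_nonneg _)

/-- Stated with a factor `diam` rather than a quotient, so that it also covers the case that `diam`
is 0. -/
theorem scale_mul_shifted_le {u v : ℕ} (hu : u < G.n) (hv : v < G.n) :
    G.scale ε * G.shifted u v ≤ G.weight ε u v * G.diam := by
  rcases G.diam_nonneg.eq_or_lt with h | h
  · have := G.shifted_le_diam hu hv
    rw [← h, mul_zero]
    exact mul_nonpos_of_nonneg_of_nonpos (Nat.cast_nonneg _) (this.trans h.ge)
  · rw [← div_le_iff₀ h]
    exact Nat.le_ceil _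

theorem weight_mul_diam_le {u v : ℕ} (hu : u < G.n) (hv : v < G.n) :
    G.weight ε u v * G.diam ≤ G.scale ε * G.shifted u v + G.diam := by
  have hs := mul_nonneg (Nat.cast_nonneg (α := ℝ) (G.scale ε)) (G.shifted_nonneg hu hv)
  rcases G.diam_nonneg.eq_or_lt with h | h
  · rw [← h]; simpa using hs
  · have := (Nat.ceil_lt_add_one (div_nonneg hs h.le)).le
    have h2 := mul_le_mul_of_nonneg_right this h.le
    rw [add_mul, div_mul_cancel₀ _ h.ne', one_mul] at h2
    exact h2

theorem scale_mul_tourLength_le (τ : Equiv.Perm (Fin G.n)) :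
    G.scale ε * G.tourLength τ ≤ weightLength (G.weight ε) τ * G.diam := by
  rw [G.tourLength_eq_sum_shifted, weightLength, Finset.mul_sum, Nat.cast_sum, Finset.sum_mul]
  exact Finset.sum_le_sum fun k _ => G.scale_mul_shifted_le (Fin.is_lt _) (Fin.is_lt _)

theorem weightLength_mul_diam_le (τ : Equiv.Perm (Fin G.n)) :
    weightLength (G.weight ε) τ * G.diam ≤ G.scale ε * G.tourLength τ + G.n * G.diam := by
  rw [G.tourLength_eq_sum_shifted, weightLength, Finset.mul_sum, Nat.cast_sum, Finset.sum_mul]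
  refine (Finset.sum_le_sum fun k _ =>
    G.weight_mul_diam_le (Fin.is_lt (τ k)) (Fin.is_lt (τ (finRotate G.n k)))).trans (le_of_eq ?_)
  simp [Finset.sum_add_distrib]

/-- The flowshop instance that is constructed from `G` and `ε`. -/
noncomputable abbrev toNWFS (hε : 0 < ε) : NWFS :=
  flow G.n (G.scale ε) G.n_pos (G.scale_pos hε) (G.weight ε)

theorem toNWFS_opt_mul_diam_le (hε : 0 < ε) :
    (G.toNWFS hε).opt * G.diam ≤ G.scale ε ^ 3 * (1 + ε) * G.opt := by
  obtain ⟨τ, -, hτ⟩ := Finset.exists_mem_eq_inf' (s := Finset.univ) Finset.univ_nonempty G.tourLength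
  obtain ⟨ρ, hρ, hρτ⟩ := G.exists_rotate τ
  have hopt : G.tourLength ρ = G.opt := by rw [hρτ]; exact hτ.symm
  have h1 : ((G.toNWFS hε).opt : ℝ) ≤ _ :=
    Int.cast_le.2 (flow_opt_le G.n_pos (G.scale_pos hε) (G.isWeight ε) ρ hρ)
  have h2 := G.weightLength_mul_diam_le (ε := ε) ρ
  rw [hopt] at h2
  have h3 := G.diam_le_opt
  have h4 := G.diam_nonneg
  have h5 := G.le_scale_mul hε
  have hn : (1 : ℝ) ≤ G.n := by exact_mod_cast G.n_pos
  have hP : (G.n : ℝ) ≤ G.scale ε := by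
    unfold scale
    exact_mod_cast Nat.le_mul_of_pos_right _ (Nat.ceil_pos.2 (by positivity))
  push_cast at h1
  set P : ℝ := (G.scale ε : ℝ)
  set n : ℝ := (G.n : ℝ)
  set W : ℝ := (weightLength (G.weight ε) ρ : ℝ)
  have hP0 : 0 ≤ P := by linarith
  calc ((G.toNWFS hε).opt : ℝ) * G.diam
      ≤ (P * P * (W + 2 * n) + (n + 2 * P) * (2 * P)) * G.diam :=
        mul_le_mul_of_nonneg_right h1 h4
    _ = P * P * (W * G.diam) + (P * P * (2 * n) + (n + 2 * P) * (2 * P)) * G.diam := by ring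
    _ ≤ P * P * (P * G.opt + n * G.diam) +
        (P * P * (2 * n) + (P + 2 * P) * (2 * P)) * G.diam := by gcongr
    _ = P ^ 3 * G.opt + P * P * (3 * n + 6) * G.diam := by ring
    _ ≤ P ^ 3 * G.opt + P * P * (P * ε) * G.opt := by
        -- Per copy, rounding loses at most `n`, the delays `2 * n`, and the share of the last job
        -- is at most 6 because `n ≤ P`. As `3 * n + 6 ≤ 9 * n`, this is where the 9 in `scale`
        -- comes from.
        have : 3 * n + 6 ≤ P * ε := by linarith
        gcongr
    _ = P ^ 3 * (1 + ε) * G.opt := by ring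

/-- An average over the copies: the shortest tour is at most the mean. The choice of `c` does not
involve `α`, so one tour serves every `α`. -/
theorem tourLength_copyTour_le (hε : 0 < ε) {α : ℝ} (hα : 1 ≤ α)
    (σ : Equiv.Perm (Fin (G.scale ε * G.scale ε * G.n))) (hσ : (G.toNWFS hε).IsApprox α σ)
    (c : Fin (G.scale ε * G.scale ε))
    (hc : ∀ c', G.tourLength (copyTour σ G.n_pos c) ≤ G.tourLength (copyTour σ G.n_pos c')) :
    G.tourLength (copyTour σ G.n_pos c) ≤ α * (1 + ε) * G.opt := by
  have h1 : (((∑ c, weightLength (G.weight ε) (copyTour σ G.n_pos c) : ℕ) : ℤ) : ℝ) ≤ _ :=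
    Int.cast_le.2 (sum_weightLength_copyTour_le G.n_pos (G.scale_pos hε) (G.isWeight ε) σ)
  have h2 := mul_le_mul_of_nonneg_right (h1.trans hσ) G.diam_nonneg
  have h3 := mul_le_mul_of_nonneg_left (G.toNWFS_opt_mul_diam_le hε) (by linarith : 0 ≤ α)
  have hP : (0 : ℝ) < G.scale ε := by exact_mod_cast G.scale_pos hε
  have h4 : (G.scale ε * G.scale ε : ℝ) * (G.scale ε * G.tourLength (copyTour σ G.n_pos c)) ≤
      (((∑ c, weightLength (G.weight ε) (copyTour σ G.n_pos c) : ℕ) : ℤ) : ℝ) * G.diam := by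
    push_cast
    rw [Finset.sum_mul]
    refine le_trans (le_of_eq ?_) (Finset.sum_le_sum fun c' _ =>
      (mul_le_mul_of_nonneg_left (hc c') hP.le).trans (G.scale_mul_tourLength_le _))
    simp
  refine le_of_mul_le_mul_left ?_ (pow_pos hP 3)
  linarith

end ATSP

/-! ### The program that constructs the flowshop instance

Natural-number variables: `6` the scale, `7`, `8`, `9` vertices and loop counters, `10` the rounded
weights, `11` the weight under construction, `12`, `13` the two parts of a copy, `14` a coordinate,
`15` a step of a wave, `16` the current job, `17` the current copy, `18` the current machine, `19` the
current value of a coordinate, `20` and `21` the copy and the vertex of each job, `22` counters for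
the copies, `23` the vertex orders of the copies, `24` the next position, `25` the best copy,
`26`, `27` the scanned job and its copy. Real variables: `2`, `3` accumulators, `4` the diameter,
`5` the length of a tour, `6` the smallest length. -/

/-- The memory contains `G` and `ε`. -/
structure State.HoldsATSP (s : State) (G : ATSP) (ε : ℝ) : Prop where
  n : s.nat 0 0 0 = G.n
  d : ∀ u < G.n, ∀ v < G.n, s.real 0 u v = G.dist u v
  eps : s.real 1 0 0 = ε

theorem State.HoldsATSP.frame {s s' : State} {G : ATSP} {ε : ℝ} {p : Program}
    (h : s.HoldsATSP G ε) (hf : Frame p s s') (h0 : p.writesNat 0 = false)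
    (h1 : p.writesReal 0 = false) (h2 : p.writesReal 1 = false) : s'.HoldsATSP G ε :=
  ⟨by rw [hf.nat 0 h0, h.n], by rw [hf.real 0 h1]; exact h.d, by rw [hf.real 1 h2, h.eps]⟩

/-- In place of a division, multiples of `n` and of `ε` are accumulated in parallel until the latter
reach 9. -/
def scaleProg : Program :=
  .seq (.setVar 6 (.const 0)) (.seq (.setRVar 2 (.const 0))
    (.loop (.not (.realLe (.const 9) (.var 2)))
      (.seq (.setVar 6 (.add (.var 6) (.var 0))) (.setRVar 2 (.add (.var 2) (.var 1))))))

theorem run_scaleProg {G : ATSP} {ε : ℝ} (hε : 0 < ε) {s : State} (hs : s.HoldsATSP G ε) :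
    Run scaleProg s (⌈9 / ε⌉₊ * 3 + 3) fun s' => s'.nat 6 0 0 = G.scale ε := by
  refine Run.mono (Run.setNat_seq (Run.setReal_seq (Run.loop (T := 2) (N := ⌈9 / ε⌉₊)
    (fun k s' => s'.nat 6 0 0 = G.n * k ∧ s'.real 2 0 0 = k * ε) ?_ ?_ ?_)))
    le_rfl fun s' _ h => h.1
  · simp [State.setNat_nat_same, State.setReal_real_same, NExp.eval, RExp.eval]
  · rintro k hk s' hf ⟨h6, h2⟩
    have h0 : s'.nat 0 0 0 = G.n := by
      rw [hf.nat 0 rfl]; simpa [State.setNat_nat_of_ne] using hs.n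
    have h1 : s'.real 1 0 0 = ε := by
      rw [hf.real 1 rfl]; simpa [State.setReal_real_of_ne] using hs.eps
    refine ⟨?_, Run.setNat_seq (Run.setReal ⟨?_, ?_⟩)⟩
    · rw [Nat.lt_ceil, lt_div_iff₀ hε] at hk
      simpa [Test.eval, RExp.eval, NExp.eval, h2] using hk
    · simp [State.setNat_nat_same, NExp.eval, h6, h0]; ring
    · simp [State.setReal_real_same, NExp.eval, RExp.eval, h1, h2]; ring
  · rintro s' hf ⟨h6, h2⟩
    have := Nat.le_ceil (9 / ε)
    rw [div_le_iff₀ hε] at this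
    simpa [Test.eval, RExp.eval, NExp.eval, h2] using this

/-- The shifted weight of an arc. -/
def shiftedExp (u v : NExp) : RExp :=
  .sub (.add (.read 0 u v) (.read 0 (.const 0) u)) (.read 0 (.const 0) v)

theorem eval_shiftedExp {G : ATSP} {s : State}
    (hd : ∀ u < G.n, ∀ v < G.n, s.real 0 u v = G.dist u v) (u v : NExp) (hu : u.eval s < G.n)
    (hv : v.eval s < G.n) : (shiftedExp u v).eval s = G.shifted (u.eval s) (v.eval s) := by
  simp [shiftedExp, RExp.eval, ATSP.shifted, hd _ hu _ hv, hd _ G.n_pos _ hu, hd _ G.n_pos _ hv,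
    NExp.eval]

def diamProg : Program :=
  .seq (.setRVar 4 (.const 0)) (.forLoop 7 (.var 0)
    (.ite (.realLe (shiftedExp (.var 7) (.const 0)) (.var 4)) .skip
      (.setRVar 4 (shiftedExp (.var 7) (.const 0)))))

theorem run_diamProg {G : ATSP} {ε : ℝ} {s : State} (hs : s.HoldsATSP G ε) :
    Run diamProg s (G.n * 4 + 3) fun s' => s'.real 4 0 0 = G.diam := by
  refine Run.mono (Run.setReal_seq (Run.forLoop (T := 2) G.n
    (fun k s' => (∀ u < k, G.shifted u 0 ≤ s'.real 4 0 0) ∧ s'.real 4 0 0 ≤ G.diam ∧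
      0 ≤ s'.real 4 0 0) rfl ?_ ?_ ?_ ?_)) le_rfl fun s' _ h => ?_
  · intro s' hf
    simpa [NExp.eval, hf.nat 0 rfl] using hs.n
  · intro k v s' h
    simpa using h
  · simp [State.setReal_real_same, RExp.eval, NExp.eval, G.diam_nonneg]
  · rintro k hk s' hf h7 ⟨h1, h2, h3⟩
    have hd : ∀ u < G.n, ∀ v < G.n, s'.real 0 u v = G.dist u v := by
      rw [hf.real 0 rfl]; simpa [State.setReal_real_of_ne] using hs.d
    have he := eval_shiftedExp hd (.var 7) (.const 0) (by simpa [NExp.eval, h7] using hk)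
      (by simpa [NExp.eval] using G.n_pos)
    simp only [NExp.eval, h7] at he
    have hle := G.shifted_le_diam hk G.n_pos
    refine Run.ite (fun hb => Run.skip ⟨fun u hu => ?_, h2, h3⟩) (fun hb => Run.setReal ⟨?_, ?_, ?_⟩)
    · rcases Nat.lt_succ_iff_lt_or_eq.1 hu with hu | rfl
      · exact h1 u hu
      · simpa [Test.eval, he, RExp.eval, NExp.eval] using hb
    · intro u hu
      simp only [Test.eval, he, RExp.eval, NExp.eval, not_le] at hb
      simp only [State.setReal_real_same, NExp.eval, he, and_self, if_true]
      rcases Nat.lt_succ_iff_lt_or_eq.1 hu with hu | rfl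
      · exact (h1 u hu).trans hb.le
      · exact le_rfl
    · simpa [State.setReal_real_same, NExp.eval, he] using hle
    · simpa [State.setReal_real_same, NExp.eval, he] using G.shifted_nonneg hk G.n_pos
  · exact le_antisymm h.2.1 (Finset.sup'_le _ _ fun u _ => h.1 u u.2)

/-- For i = 0, 1, … up to the scale, real `3` holds i times the shifted weight, natural `11` the
rounded-up quotient of this by the diameter, and real `2` that rounded quotient times the diameter.
-/
def weightProg : Program :=
  .forLoop 7 (.var 0) (.forLoop 8 (.var 0)
    (.seq (.setVar 11 (.const 0)) (.seq (.setRVar 2 (.const 0)) (.seq (.setRVar 3 (.const 0))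
      (.seq
        (.forLoop 9 (.var 6) (.seq (.setRVar 3 (.add (.var 3) (shiftedExp (.var 7) (.var 8))))
          (.ite (.realLe (.var 3) (.var 2)) .skip
            (.seq (.setVar 11 (.add (.var 11) (.const 1)))
              (.setRVar 2 (.add (.var 2) (.var 4)))))))
        (.setNat 10 (.var 7) (.var 8) (.var 11)))))))

theorem ceil_eq_ite {x y : ℝ} (hxy : x ≤ y) (hy : y ≤ x + 1) (hx : 0 ≤ x) :
    ⌈y⌉₊ = if y ≤ ⌈x⌉₊ then ⌈x⌉₊ else ⌈x⌉₊ + 1 := by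
  split_ifs with h
  · exact le_antisymm (Nat.ceil_le.2 h) (Nat.ceil_mono hxy)
  · refine le_antisymm ?_ (Nat.succ_le_of_lt (Nat.lt_ceil.2 (not_le.1 h)))
    exact (Nat.ceil_mono hy).trans (Nat.ceil_add_one hx).le

/-- Because `a ≤ D`, the quotient grows by at most one per step, so a single comparison of sums
decides whether its ceiling increases. -/
theorem ceil_mul_div_succ (i : ℕ) {a D : ℝ} (ha : 0 ≤ a) (haD : a ≤ D) :
    ⌈((i + 1 : ℕ) : ℝ) * a / D⌉₊ = if i * a + a ≤ ⌈(i : ℝ) * a / D⌉₊ * D then ⌈(i : ℝ) * a / D⌉₊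
      else ⌈(i : ℝ) * a / D⌉₊ + 1 := by
  have e : ((i + 1 : ℕ) : ℝ) * a = i * a + a := by push_cast; ring
  rw [e]
  rcases (ha.trans haD).eq_or_lt with h | h
  · obtain rfl : a = 0 := le_antisymm (haD.trans h.ge) ha
    simp
  · rw [ceil_eq_ite (x := i * a / D)]
    · simp only [div_le_iff₀ h]
    · exact div_le_div_of_nonneg_right (by linarith) h.le
    · rw [add_div]
      linarith [(div_le_one h).2 haD]
    · positivity

theorem run_weightProg {G : ATSP} {ε : ℝ} {s : State} (hs : s.HoldsATSP G ε)
    (hP : s.nat 6 0 0 = G.scale ε) (hD : s.real 4 0 0 = G.diam) :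
    Run weightProg s (G.n * (G.n * (G.scale ε * 6 + 8) + 4) + 2)
      fun s' => ∀ u < G.n, ∀ v < G.n, s'.nat 10 u v = G.weight ε u v := by
  refine Run.forLoop G.n (fun k s' => ∀ u < k, ∀ v < G.n, s'.nat 10 u v = G.weight ε u v) rfl
    ?_ ?_ ?_ ?_
  · intro s' hf
    simpa [NExp.eval, hf.nat 0 rfl] using hs.n
  · intro k v s' h
    simpa [State.setNat_nat_of_ne] using h
  · simp
  intro u hu s1 hf1 h7 hw
  refine Run.mono (Run.forLoop (T := G.scale ε * 6 + 6) G.n (fun k s' =>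
    (∀ u' < u, ∀ v < G.n, s'.nat 10 u' v = G.weight ε u' v) ∧
    ∀ v < k, s'.nat 10 u v = G.weight ε u v) rfl ?_ ?_ ⟨hw, by simp⟩ ?_) le_rfl ?_
  · intro s' hf
    simpa [NExp.eval, hf.nat 0 rfl, hf1.nat 0 rfl] using hs.n
  · intro k v s' h
    simpa [State.setNat_nat_of_ne] using h
  · rintro v hv s2 hf2 h8 ⟨hw1, hw2⟩
    have g7 : s2.nat 7 0 0 = u := by rw [hf2.nat 7 rfl, h7]
    refine Run.mono (Run.setNat_seq (Run.setReal_seq (Run.setReal_seq (Run.seq (T' := 1)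
      (R := fun s' => s'.nat 11 0 0 = G.weight ε u v)
      (Run.mono (Run.forLoop (T := 4) (G.scale ε)
        (fun k s' => s'.nat 11 0 0 = ⌈k * G.shifted u v / G.diam⌉₊ ∧
          s'.real 2 0 0 = ⌈k * G.shifted u v / G.diam⌉₊ * G.diam ∧
          s'.real 3 0 0 = k * G.shifted u v) rfl ?_ ?_ ?_ ?_) le_rfl fun s' _ h => h.1) ?_))))
      (by omega) fun _ _ h => h
    · intro s' hf
      simp only [NExp.eval, hf.nat 6 rfl]
      simpa [State.setNat_nat_of_ne, hf2.nat 6 rfl, hf1.nat 6 rfl] using hP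
    · intro k v s' h
      simpa [State.setNat_nat_of_ne] using h
    · simp [State.setNat_nat_same, State.setReal_real_same, State.setReal_real_of_ne, NExp.eval,
        RExp.eval]
    · rintro i hi s3 hf3 - ⟨i1, i2, i3⟩
      have hd : ∀ u < G.n, ∀ v < G.n, s3.real 0 u v = G.dist u v := by
        rw [hf3.real 0 rfl]
        simpa [State.setReal_real_of_ne, hf2.real 0 rfl, hf1.real 0 rfl] using hs.d
      have h4 : s3.real 4 0 0 = G.diam := by
        rw [hf3.real 4 rfl]
        simpa [State.setReal_real_of_ne, hf2.real 4 rfl, hf1.real 4 rfl] using hD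
      have k7 : s3.nat 7 0 0 = u := by
        rw [hf3.nat 7 rfl]; simpa [State.setNat_nat_of_ne] using g7
      have k8 : s3.nat 8 0 0 = v := by
        rw [hf3.nat 8 rfl]; simpa [State.setNat_nat_of_ne] using h8
      have he := eval_shiftedExp hd (.var 7) (.var 8) (by simpa [NExp.eval, k7] using hu)
        (by simpa [NExp.eval, k8] using hv)
      simp only [NExp.eval, k7, k8] at he
      have hc := ceil_mul_div_succ i (G.shifted_nonneg hu hv) (G.shifted_le_diam hu hv)
      refine Run.setReal_seq (Run.ite (T := 2) (fun hb => Run.mono (T := 1) (Run.skip ?_) (by omega)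
        fun _ _ h => h) (fun hb => Run.setNat_seq (Run.setReal ?_)))
      all_goals
        simp only [Test.eval, RExp.eval, NExp.eval, State.setReal_real_same,
          State.setReal_real_of_ne, ne_eq, Nat.reduceEqDiff, not_false_eq_true,
          i2, i3, he, and_self, if_true] at hb
        rw [hc]
        simp only [hb, if_true, if_false]
      · simp [State.setReal_real_same, State.setReal_real_of_ne, NExp.eval, RExp.eval, i1, i2, i3,
          he]
        ring
      · simp [State.setReal_real_same, State.setReal_real_of_ne, State.setNat_nat_same, NExp.eval,
          RExp.eval, i1, i2, i3, he, h4]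
        exact ⟨by ring, by ring⟩
    · intro s3 hf3 h11
      have k7 : s3.nat 7 0 0 = u := by
        rw [hf3.nat 7 rfl]; simpa [State.setNat_nat_of_ne] using g7
      have k8 : s3.nat 8 0 0 = v := by
        rw [hf3.nat 8 rfl]; simpa [State.setNat_nat_of_ne] using h8
      have k10 : s3.nat 10 = s2.nat 10 := by
        rw [hf3.nat 10 rfl]; simp [State.setNat_nat_of_ne]
      refine Run.setNat ⟨fun u' hu' v' hv' => ?_, fun v' hv' => ?_⟩
      · simp only [State.setNat_nat_same, NExp.eval, k7, k8, k10, h11]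
        rw [if_neg (by omega)]
        exact hw1 u' hu' v' hv'
      · simp only [State.setNat_nat_same, NExp.eval, k7, k8, k10, h11]
        by_cases h : v' = v
        · simp [h]
        · simpa [h] using hw2 v' (by omega)
  · rintro s' - ⟨h1, h2⟩ u' hu'
    rcases Nat.lt_succ_iff_lt_or_eq.1 hu' with h | rfl
    · exact h1 u' h
    · exact h2

/-- The memory contains the scale `P` and the rounded weights `w` on `n` vertices. -/
structure State.HoldsWeights (s : State) (n P : ℕ) (w : ℕ → ℕ → ℕ) : Prop where
  order : s.nat 0 0 0 = n
  scale : s.nat 6 0 0 = P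
  weight : ∀ u < n, ∀ v < n, s.nat 10 u v = w u v

theorem State.HoldsWeights.frame {s s' : State} {n P : ℕ} {w : ℕ → ℕ → ℕ} {p : Program}
    (h : s.HoldsWeights n P w) (hf : Frame p s s') (h0 : p.writesNat 0 = false)
    (h6 : p.writesNat 6 = false) (h10 : p.writesNat 10 = false) : s'.HoldsWeights n P w :=
  ⟨by rw [hf.nat 0 h0, h.order], by rw [hf.nat 6 h6, h.scale], by rw [hf.nat 10 h10]; exact h.weight⟩

theorem State.HoldsWeights.setNat {s : State} {n P : ℕ} {w : ℕ → ℕ → ℕ}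
    (h : s.HoldsWeights n P w) {x : ℕ} (i j v : ℕ) (h0 : 0 ≠ x) (h6 : 6 ≠ x) (h10 : 10 ≠ x) :
    (s.setNat x i j v).HoldsWeights n P w :=
  ⟨by rw [State.setNat_nat_of_ne _ _ _ _ h0, h.order],
    by rw [State.setNat_nat_of_ne _ _ _ _ h6, h.scale],
    by rw [State.setNat_nat_of_ne _ _ _ _ h10]; exact h.weight⟩

/-- Equality of natural numbers. -/
def Test.natEq (a b : NExp) : Test := .and (.natLe a b) (.natLe b a)

theorem Test.eval_natEq (s : State) (a b : NExp) :
    (Test.natEq a b).eval s ↔ a.eval s = b.eval s := by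
  simp only [Test.natEq, Test.eval]
  omega

def coordProg : Program :=
  .ite (.natLe (.add (.var 14) (.const 1)) (.var 0)) (.setVar 19 (.read 10 (.var 7) (.var 14)))
    (.ite (.natEq (.var 14) (.add (.var 0) (.var 12))) (.setVar 19 (.read 10 (.var 7) (.const 0)))
      (.ite (.natEq (.var 14) (.add (.add (.var 0) (.var 6)) (.var 13)))
        (.setVar 19 (.read 10 (.var 7) (.const 0))) (.setVar 19 (.const 0))))

/-- The variables describe the job `x`. -/
structure State.HoldsJob (s : State) (n P x : ℕ) : Prop where
  vertex : s.nat 7 0 0 = x % n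
  fst : s.nat 12 0 0 = x / n / P
  snd : s.nat 13 0 0 = x / n % P

theorem run_coordProg {n P : ℕ} {w : ℕ → ℕ → ℕ} (hn : 0 < n) {s : State}
    (hw : s.HoldsWeights n P w) {x q : ℕ} (hx : s.HoldsJob n P x) (hq : s.nat 14 0 0 = q) :
    Run coordProg s 4 fun s' => s'.nat 19 0 0 = coord n P w x q := by
  have hu := Nat.mod_lt x hn
  refine Run.ite (T := 3) (fun h1 => Run.mono (Run.setNat (Q := fun s' => s'.nat 19 0 0 = _) ?_)
      (by omega) fun _ _ h => h) fun h1 =>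
    Run.ite (T := 2) (fun h2 => Run.mono (Run.setNat (Q := fun s' => s'.nat 19 0 0 = _) ?_)
      (by omega) fun _ _ h => h) fun h2 =>
    Run.ite (T := 1) (fun h3 => Run.setNat ?_) fun h3 => Run.setNat ?_
  all_goals
    simp only [Test.eval, Test.eval_natEq, NExp.eval, hq, hw.order, hw.scale, hx.vertex, hx.fst, hx.snd,
      State.setNat_nat_same, and_self, if_true, coord] at *
  · rw [if_pos (by omega)]
    exact hw.weight _ hu _ (by omega)
  · rw [if_neg (by omega), if_pos (Or.inl h2)]
    exact hw.weight _ hu _ hn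
  · rw [if_neg (by omega), if_pos (Or.inr h3)]
    exact hw.weight _ hu _ hn
  · rw [if_neg (by omega), if_neg (by tauto)]

/-- The minimum of two natural numbers. -/
def minExp (a b : NExp) : NExp := .sub a (.sub a b)

theorem eval_minExp (s : State) (a b : NExp) : (minExp a b).eval s = min (a.eval s) (b.eval s) := by
  simp only [minExp, NExp.eval]
  omega

def waveExp (P F t : NExp) : NExp := .sub (minExp F t) (minExp F (.sub t P))

theorem eval_waveExp (s : State) (P F t : NExp) :
    (waveExp P F t).eval s = wave (P.eval s) (F.eval s) (t.eval s) := by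
  simp only [waveExp, NExp.eval, eval_minExp, wave]

/-- Perform the operations that belong to one coordinate. -/
def waveProg : Program :=
  .forLoop 15 (.add (.var 6) (.var 6))
    (.seq
      (.setNat 3 (.var 16) (.var 18)
        (.sub (.add (.const 1) (waveExp (.var 6) (.var 19) (.add (.var 15) (.const 1))))
          (waveExp (.var 6) (.var 19) (.var 15))))
      (.setVar 18 (.add (.var 18) (.const 1))))

theorem run_waveProg {n P : ℕ} {w : ℕ → ℕ → ℕ} {s : State} {x q : ℕ} (hP : s.nat 6 0 0 = P)
    (hx : s.nat 16 0 0 = x) (hF : s.nat 19 0 0 = coord n P w x q) (hk : s.nat 18 0 0 = q * (2 * P)) :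
    Run waveProg s (2 * P * 4 + 2) fun s' => s'.nat 18 0 0 = (q + 1) * (2 * P) ∧
      ∀ x' k, s'.nat 3 x' k = if x' = x ∧ q * (2 * P) ≤ k ∧ k < (q + 1) * (2 * P) then
        procTime n P w x k else s.nat 3 x' k := by
  refine Run.mono (Run.forLoop (T := 2) (2 * P) (fun r s' => s'.nat 18 0 0 = q * (2 * P) + r ∧
      ∀ x' k, s'.nat 3 x' k = if x' = x ∧ q * (2 * P) ≤ k ∧ k < q * (2 * P) + r then
        procTime n P w x k else s.nat 3 x' k) rfl ?_ ?_ ?_ ?_) le_rfl fun s' _ h => ?_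
  · intro s' hf
    simp only [NExp.eval, hf.nat 6 rfl, hP]
    ring
  · intro k v s' h
    simpa [State.setNat_nat_of_ne] using h
  · refine ⟨by simpa using hk, fun x' k => ?_⟩
    rw [if_neg (by omega)]
  · rintro r hr s' hf h15 ⟨h1, h2⟩
    have e := (Nat.div_mod_unique (a := q * (2 * P) + r) (b := 2 * P) (c := r) (d := q)
      (by omega)).2 ⟨by ring, hr⟩
    have k6 : s'.nat 6 0 0 = P := by rw [hf.nat 6 rfl, hP]
    have k16 : s'.nat 16 0 0 = x := by rw [hf.nat 16 rfl, hx]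
    have k19 : s'.nat 19 0 0 = coord n P w x q := by rw [hf.nat 19 rfl, hF]
    refine Run.setNat_seq (Run.setNat ⟨?_, fun x' k => ?_⟩)
    · simp [State.setNat_nat_same, State.setNat_nat_of_ne, NExp.eval, h1]
      ring
    · rw [State.setNat_nat_of_ne _ _ _ _ (by decide), State.setNat_nat_same]
      simp only [NExp.eval, eval_waveExp, h1, k6, k16, k19, h15]
      by_cases hk' : x' = x ∧ k = q * (2 * P) + r
      · obtain ⟨rfl, rfl⟩ := hk'
        rw [if_pos ⟨rfl, rfl⟩, if_pos (by omega), procTime, e.1, e.2]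
      · rw [if_neg hk', h2]
        have : (x' = x ∧ q * (2 * P) ≤ k ∧ k < q * (2 * P) + r) ↔
            (x' = x ∧ q * (2 * P) ≤ k ∧ k < q * (2 * P) + (r + 1)) := by omega
        simp only [this]
  · have : (q + 1) * (2 * P) = q * (2 * P) + 2 * P := by ring
    rw [this]
    exact h

def jobProg : Program :=
  .seq (.setNat 20 (.var 16) (.const 0) (.var 17)) (.seq (.setNat 21 (.var 16) (.const 0) (.var 7))
    (.seq (.setVar 18 (.const 0))
      (.seq (.forLoop 14 (.add (.add (.var 0) (.var 6)) (.var 6)) (.seq coordProg waveProg))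
        (.setVar 16 (.add (.var 16) (.const 1))))))

theorem run_jobProg {n P : ℕ} {w : ℕ → ℕ → ℕ} (hn : 0 < n) {s : State} {x : ℕ}
    (hw : s.HoldsWeights n P w) (hj : s.HoldsJob n P x) (hx : s.nat 16 0 0 = x)
    (hc : s.nat 17 0 0 = x / n) :
    Run jobProg s ((n + 2 * P) * (8 * P + 8) + 6) fun s' => s'.nat 16 0 0 = x + 1 ∧
      s'.nat 18 0 0 = (n + 2 * P) * (2 * P) ∧
      (∀ x', s'.nat 20 x' 0 = if x' = x then x / n else s.nat 20 x' 0) ∧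
      (∀ x', s'.nat 21 x' 0 = if x' = x then x % n else s.nat 21 x' 0) ∧
      ∀ x' k, s'.nat 3 x' k = if x' = x ∧ k < (n + 2 * P) * (2 * P) then
        procTime n P w x k else s.nat 3 x' k := by
  refine Run.mono (Run.setNat_seq (Run.setNat_seq (Run.setNat_seq (Run.seq (T' := 1)
    (Run.forLoop (T := 8 * P + 6) (n + 2 * P) (fun q s' => s'.nat 18 0 0 = q * (2 * P) ∧
      ∀ x' k, s'.nat 3 x' k = if x' = x ∧ k < q * (2 * P) then
        procTime n P w x k else s.nat 3 x' k) rfl ?_ ?_ ?_ ?_) ?_))))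
    (le_of_eq (by ring)) fun _ _ h => h
  · intro s' hf
    simp only [NExp.eval, hf.nat 6 rfl, hf.nat 0 rfl]
    simp [State.setNat_nat_of_ne, hw.order, hw.scale]
    ring
  · intro k v s' h
    simpa [State.setNat_nat_of_ne] using h
  · simp [State.setNat_nat_of_ne, State.setNat_nat_same, NExp.eval]
  · rintro q hq s1 hf1 h14 ⟨h18, h3⟩
    have hw1 : s1.HoldsWeights n P w :=
      (((hw.setNat _ _ _ (by decide) (by decide) (by decide)).setNat _ _ _ (by decide) (by decide)
        (by decide)).setNat _ _ _ (by decide) (by decide) (by decide)).frame hf1 rfl rfl rfl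
    have hj1 : s1.HoldsJob n P x := by
      constructor
      · rw [hf1.nat 7 rfl]; simpa [State.setNat_nat_of_ne] using hj.vertex
      · rw [hf1.nat 12 rfl]; simpa [State.setNat_nat_of_ne] using hj.fst
      · rw [hf1.nat 13 rfl]; simpa [State.setNat_nat_of_ne] using hj.snd
    have hx1 : s1.nat 16 0 0 = x := by
      rw [hf1.nat 16 rfl]; simpa [State.setNat_nat_of_ne] using hx
    refine Run.mono (Run.seq (run_coordProg hn hw1 hj1 h14) fun s2 hf2 h19 =>
      Run.mono (run_waveProg (n := n) (w := w) (x := x) (q := q) (hw1.frame hf2 rfl rfl rfl).scale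
        (by rw [hf2.nat 16 rfl, hx1]) h19 (by rw [hf2.nat 18 rfl, h18])) le_rfl
      fun s3 hf3 h => (⟨h.1, fun x' k => ?_⟩ : _ ∧ _)) (by omega) fun _ _ h => h
    rw [h.2, hf2.nat 3 rfl, h3]
    have e : (q + 1) * (2 * P) = q * (2 * P) + 2 * P := by ring
    rw [e]
    by_cases h1 : x' = x ∧ q * (2 * P) ≤ k ∧ k < q * (2 * P) + 2 * P
    · rw [if_pos h1, if_pos ⟨h1.1, h1.2.2⟩]
    · rw [if_neg h1]
      have : (x' = x ∧ k < q * (2 * P)) ↔ (x' = x ∧ k < q * (2 * P) + 2 * P) := by omega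
      simp only [this]
  · rintro s1 hf1 ⟨h18, h3⟩
    have k20 := hf1.nat 20 rfl
    have k21 := hf1.nat 21 rfl
    have k16 := hf1.nat 16 rfl
    simp [State.setNat_nat_of_ne, State.setNat_nat_same, NExp.eval, hx, hc, hj.vertex] at k20 k21 k16
    refine Run.setNat ⟨?_, ?_, ?_, ?_, ?_⟩
    · simp [State.setNat_nat_same, NExp.eval, k16, hx]
    · simpa [State.setNat_nat_of_ne] using h18
    · simp [State.setNat_nat_of_ne, k20]
    · simp [State.setNat_nat_of_ne, k21]
    · simpa [State.setNat_nat_of_ne] using h3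

/-- Nested loops over the two digits and the vertex, with running counters for job and copy, make
divisions unnecessary. The counters `22` are cleared explicitly, since nothing is assumed about
their old content. -/
def jobsProg : Program :=
  .seq (.setVar 16 (.const 0)) (.seq (.setVar 17 (.const 0))
    (.forLoop 12 (.var 6) (.forLoop 13 (.var 6)
      (.seq (.setNat 22 (.var 17) (.const 0) (.const 0))
        (.seq (.forLoop 7 (.var 0) jobProg) (.setVar 17 (.add (.var 17) (.const 1))))))))

/-- The first `m` jobs have been constructed; `T` is the previous content of the array of
processing times. -/
structure State.HoldsJobs (s : State) (T : ℕ → ℕ → ℕ) (n P : ℕ) (w : ℕ → ℕ → ℕ) (m : ℕ) :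
    Prop where
  count : s.nat 16 0 0 = m
  machines : 0 < m → s.nat 18 0 0 = (n + 2 * P) * (2 * P)
  copy : ∀ x < m, s.nat 20 x 0 = x / n
  vertex : ∀ x < m, s.nat 21 x 0 = x % n
  time : ∀ x k, s.nat 3 x k = if x < m ∧ k < (n + 2 * P) * (2 * P) then procTime n P w x k else T x k

/-- The variable `17` has the value `c`, and the first `c` counters are zero. -/
structure State.HoldsCopies (s : State) (c : ℕ) : Prop where
  count : s.nat 17 0 0 = c
  zero : ∀ c' < c, s.nat 22 c' 0 = 0

theorem State.HoldsJobs.congr {s s' : State} {T : ℕ → ℕ → ℕ} {n P : ℕ} {w : ℕ → ℕ → ℕ} {m : ℕ}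
    (h : s.HoldsJobs T n P w m) (h16 : s'.nat 16 = s.nat 16) (h18 : s'.nat 18 = s.nat 18)
    (h20 : s'.nat 20 = s.nat 20) (h21 : s'.nat 21 = s.nat 21) (h3 : s'.nat 3 = s.nat 3) :
    s'.HoldsJobs T n P w m :=
  ⟨h16 ▸ h.count, h18 ▸ h.machines, h20 ▸ h.copy, h21 ▸ h.vertex, h3 ▸ h.time⟩

theorem run_jobsProg {n P : ℕ} {w : ℕ → ℕ → ℕ} (hn : 0 < n) (hP : 0 < P) {s : State}
    (hw : s.HoldsWeights n P w) :
    Run jobsProg s (P * (P * (n * ((n + 2 * P) * (8 * P + 8) + 8) + 6) + 4) + 4) fun s' =>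
      s'.HoldsJobs (s.nat 3) n P w (P * P * n) ∧ s'.HoldsCopies (P * P) := by
  refine Run.mono (Run.setNat_seq (Run.setNat_seq (Run.forLoop
    (T := P * (n * ((n + 2 * P) * (8 * P + 8) + 8) + 6) + 2) P
    (fun a s' => s'.HoldsJobs (s.nat 3) n P w (a * P * n) ∧ s'.HoldsCopies (a * P)) rfl ?_ ?_ ?_ ?_)))
    (le_of_eq (by ring)) fun _ _ h => h
  · intro s' hf
    simp only [NExp.eval, hf.nat 6 rfl]
    simp [State.setNat_nat_of_ne, hw.scale]
  · rintro k v s' ⟨h1, h2⟩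
    refine ⟨h1.congr ?_ ?_ ?_ ?_ ?_, ⟨?_, ?_⟩⟩
    all_goals simp [State.setNat_nat_of_ne]
    · exact h2.count
    · exact h2.zero
  · constructor <;> constructor <;>
      simp [State.setNat_nat_same, State.setNat_nat_of_ne, NExp.eval]
  rintro a ha s1 hf1 h12 ⟨hj1, hc1⟩
  have hw1 : s1.HoldsWeights n P w :=
    ((hw.setNat _ _ _ (by decide) (by decide) (by decide)).setNat _ _ _ (by decide) (by decide)
      (by decide)).frame hf1 rfl rfl rfl
  refine Run.mono (Run.forLoop (T := n * ((n + 2 * P) * (8 * P + 8) + 8) + 4) P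
    (fun b s' => s'.HoldsJobs (s.nat 3) n P w ((a * P + b) * n) ∧ s'.HoldsCopies (a * P + b))
    rfl ?_ ?_ ?_ ?_) le_rfl ?_
  · intro s' hf
    simp only [NExp.eval, hf.nat 6 rfl, hw1.scale]
  · rintro k v s' ⟨h1, h2⟩
    refine ⟨h1.congr ?_ ?_ ?_ ?_ ?_, ⟨?_, ?_⟩⟩
    all_goals simp [State.setNat_nat_of_ne]
    · exact h2.count
    · exact h2.zero
  · exact ⟨hj1, hc1⟩
  · rintro b hb s2 hf2 h13 ⟨hj2, hc2⟩
    have hw2 := hw1.frame hf2 rfl rfl rfl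
    have g12 : s2.nat 12 0 0 = a := by rw [hf2.nat 12 rfl, h12]
    refine Run.mono (Run.setNat_seq (Run.seq (T' := 1)
      (Run.forLoop (T := (n + 2 * P) * (8 * P + 8) + 6) n
      (fun u s' => s'.HoldsJobs (s.nat 3) n P w ((a * P + b) * n + u)) rfl ?_ ?_ ?_ ?_) ?_))
      (le_of_eq (by ring)) fun _ _ h => h
    · intro s' hf
      simp only [NExp.eval, hf.nat 0 rfl]
      simp [State.setNat_nat_of_ne, hw2.order]
    · rintro k v s' h1
      refine h1.congr ?_ ?_ ?_ ?_ ?_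
      all_goals simp [State.setNat_nat_of_ne]
    · refine hj2.congr ?_ ?_ ?_ ?_ ?_
      all_goals simp [State.setNat_nat_of_ne]
    · rintro u hu s3 hf3 h7 hj3
      have hw3 := (hw2.setNat _ _ _ (by decide) (by decide) (by decide)).frame hf3 rfl rfl rfl
      have g17 : s3.nat 17 0 0 = a * P + b := by
        rw [hf3.nat 17 rfl]; simpa [State.setNat_nat_of_ne] using hc2.count
      have e := (Nat.div_mod_unique (a := (a * P + b) * n + u) (b := n) (c := u) (d := a * P + b)
        hn).2 ⟨by ring, hu⟩
      have e' := (Nat.div_mod_unique (a := a * P + b) (b := P) (c := b) (d := a)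
        hP).2 ⟨by ring, hb⟩
      refine Run.mono (run_jobProg hn (x := (a * P + b) * n + u) hw3 ⟨?_, ?_, ?_⟩ hj3.count ?_)
        le_rfl ?_
      · rw [e.2, h7]
      · rw [e.1, e'.1, hf3.nat 12 rfl]; simpa [State.setNat_nat_of_ne] using g12
      · rw [e.1, e'.2, hf3.nat 13 rfl]; simpa [State.setNat_nat_of_ne] using h13
      · rw [e.1, g17]
      · rintro s4 hf4 ⟨i1, i2, i3, i4, i5⟩
        refine ⟨i1, fun _ => i2, fun x hx => ?_, fun x hx => ?_, fun x k => ?_⟩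
        · rw [i3]
          split_ifs with h
          · rw [h]
          · exact hj3.copy x (by omega)
        · rw [i4]
          split_ifs with h
          · rw [h]
          · exact hj3.vertex x (by omega)
        · rw [i5, hj3.time]
          by_cases h : x = (a * P + b) * n + u
          · subst h
            simp
          · have : x < (a * P + b) * n + (u + 1) ↔ x < (a * P + b) * n + u := by omega
            simp only [h, this, false_and, if_false]
    · intro s3 hf3 hj3
      have k17 := hf3.nat 17 rfl
      have k22 := hf3.nat 22 rfl
      simp only [State.setNat_nat_of_ne _ _ _ _ (show (17 : ℕ) ≠ 22 by decide),
        State.setNat_nat_same] at k17 k22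
      refine Run.setNat ⟨?_, ?_, ?_⟩
      · have e : (a * P + (b + 1)) * n = (a * P + b) * n + n := by ring
        rw [e]
        refine hj3.congr ?_ ?_ ?_ ?_ ?_
        all_goals simp [State.setNat_nat_of_ne]
      · simp only [State.setNat_nat_same, NExp.eval, k17, hc2.count, and_self, if_true]
        ring
      · intro c hc
        simp only [State.setNat_nat_of_ne _ _ _ _ (show (22 : ℕ) ≠ 17 by decide), k22, NExp.eval,
          hc2.count, and_true]
        split_ifs with h
        · rfl
        · exact hc2.zero c (by omega)
  · rintro s' - ⟨h1, h2⟩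
    have e : (a + 1) * P = a * P + P := by ring
    rw [e]
    exact ⟨h1, h2⟩

/-- The program that constructs the flowshop instance. -/
def buildProg : Program :=
  .seq scaleProg (.seq diamProg (.seq weightProg (.seq jobsProg
    (.seq (.setVar 1 (.var 16)) (.setVar 2 (.var 18))))))

/-- The state after the construction of the flowshop instance in the state `s₀`. -/
structure State.Built (s s₀ : State) (G : ATSP) (ε : ℝ) : Prop where
  input : s.HoldsATSP G ε
  jobs : s.HoldsJobs (s₀.nat 3) G.n (G.scale ε) (G.weight ε) (G.scale ε * G.scale ε * G.n)
  copies : s.HoldsCopies (G.scale ε * G.scale ε)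
  numJobs : ∀ i j, s.nat 1 i j =
    if i = 0 ∧ j = 0 then G.scale ε * G.scale ε * G.n else s₀.nat 1 i j
  numMachines : ∀ i j, s.nat 2 i j =
    if i = 0 ∧ j = 0 then (G.n + 2 * G.scale ε) * (2 * G.scale ε) else s₀.nat 2 i j

/-- A bound for the running time of the construction. -/
def buildTime (n P e : ℕ) : ℕ :=
  (e * 3 + 3) + ((n * 4 + 3) + ((n * (n * (P * 6 + 8) + 4) + 2) +
    ((P * (P * (n * ((n + 2 * P) * (8 * P + 8) + 8) + 6) + 4) + 4) + 2)))

/-- The initial memory is arbitrary apart from `G` and `ε`, because the construction is repeated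
after the flowshop subroutine has run. `Built` describes the arrays 1 to 3 completely, so that they
can be matched with the input of that subroutine. -/
theorem run_buildProg {G : ATSP} {ε : ℝ} (hε : 0 < ε) {s : State} (hs : s.HoldsATSP G ε) :
    Run buildProg s (buildTime G.n (G.scale ε) ⌈9 / ε⌉₊) fun s' => s'.Built s G ε := by
  refine Run.seq (run_scaleProg hε hs) fun s1 hf1 h1 => ?_
  have hs1 := hs.frame hf1 rfl rfl rfl
  refine Run.seq (run_diamProg hs1) fun s2 hf2 h2 => ?_
  have hs2 := hs1.frame hf2 rfl rfl rfl
  have g6 : s2.nat 6 0 0 = G.scale ε := by rw [hf2.nat 6 rfl, h1]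
  refine Run.seq (run_weightProg hs2 g6 h2) fun s3 hf3 h3 => ?_
  have hs3 := hs2.frame hf3 rfl rfl rfl
  have hP := G.scale_pos hε
  refine Run.seq (run_jobsProg G.n_pos hP (⟨hs3.n, by rw [hf3.nat 6 rfl, g6], h3⟩ :
    s3.HoldsWeights G.n (G.scale ε) (G.weight ε))) fun s4 hf4 h4 => ?_
  have hs4 := hs3.frame hf4 rfl rfl rfl
  have e1 : s4.nat 1 = s.nat 1 := by
    rw [hf4.nat 1 rfl, hf3.nat 1 rfl, hf2.nat 1 rfl, hf1.nat 1 rfl]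
  have e2 : s4.nat 2 = s.nat 2 := by
    rw [hf4.nat 2 rfl, hf3.nat 2 rfl, hf2.nat 2 rfl, hf1.nat 2 rfl]
  have e3 : s3.nat 3 = s.nat 3 := by
    rw [hf3.nat 3 rfl, hf2.nat 3 rfl, hf1.nat 3 rfl]
  -- The number of machines is read off from variable `18`, which is meaningful only once some job
  -- has been written.
  have hN : 0 < G.scale ε * G.scale ε * G.n := Nat.mul_pos (Nat.mul_pos hP hP) G.n_pos
  refine Run.mono (Run.setNat_seq (T := 1) (Run.setNat (Q := fun s' => s'.nat =
    ((s4.setNat 1 0 0 (s4.nat 16 0 0)).setNat 2 0 0 (s4.nat 18 0 0)).nat) ?_)) le_rfl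
    fun s5 hf5 h5 => ?_
  · simp [NExp.eval, State.setNat_nat_of_ne]
  · refine ⟨hs4.frame hf5 rfl rfl rfl, ?_, ⟨?_, ?_⟩, fun i j => ?_, fun i j => ?_⟩
    · rw [← e3]
      exact h4.1.congr (hf5.nat _ rfl) (hf5.nat _ rfl) (hf5.nat _ rfl) (hf5.nat _ rfl)
        (hf5.nat _ rfl)
    · rw [hf5.nat 17 rfl]; exact h4.2.count
    · rw [hf5.nat 22 rfl]; exact h4.2.zero
    · rw [h5, State.setNat_nat_of_ne _ _ _ _ (by decide), State.setNat_nat_same, e1, h4.1.count]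
    · rw [h5, State.setNat_nat_same, State.setNat_nat_of_ne _ _ _ _ (by decide), e2,
        h4.1.machines hN]

/-! ### The program that extracts a tour from a job order -/

/-- Distribute the jobs to the copies. -/
def scanProg : Program :=
  .forLoop 9 (.var 16)
    (.seq (.setVar 26 (.read 4 (.var 9) (.const 0)))
      (.seq (.setVar 27 (.read 20 (.var 26) (.const 0)))
        (.seq (.setNat 23 (.var 27) (.read 22 (.var 27) (.const 0)) (.read 21 (.var 26) (.const 0)))
          (.setNat 22 (.var 27) (.const 0) (.add (.read 22 (.var 27) (.const 0)) (.const 1))))))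

/-- The counters hold `copyCount`, so each job's vertex is written at the cell given by
`copyPosition`. -/
theorem run_scanProg {K n : ℕ} (hn : 0 < n) (σ : Equiv.Perm (Fin (K * n))) {s : State}
    (hσ : s.HoldsSchedule σ) (h16 : s.nat 16 0 0 = K * n)
    (h20 : ∀ x < K * n, s.nat 20 x 0 = x / n) (h21 : ∀ x < K * n, s.nat 21 x 0 = x % n)
    (h22 : ∀ c < K, s.nat 22 c 0 = 0) :
    Run scanProg s (K * n * 6 + 2) fun s' =>
      ∀ (c : Fin K) (i : Fin n), s'.nat 23 c i = copyTour σ hn c i := by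
  refine Run.mono (Run.forLoop (T := 4) (K * n) (fun k s' =>
    (∀ c < K, s'.nat 22 c 0 = copyCount σ k c) ∧
    ∀ k' < k, s'.nat 23 (jobAt σ k' / n) (copyCount σ k' (jobAt σ k' / n)) = jobAt σ k' % n)
    rfl ?_ ?_ ?_ ?_) le_rfl ?_
  · intro s' hf
    simp only [NExp.eval, hf.nat 16 rfl, h16]
  · intro k v s' h
    simpa [State.setNat_nat_of_ne] using h
  · simpa [copyCount_zero] using h22
  · rintro k hk s' hf h9 ⟨i1, i2⟩
    have hx : jobAt σ k < K * n := by rw [jobAt, dif_pos hk]; exact Fin.is_lt _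
    have k4 : s'.nat 4 k 0 = jobAt σ k := by
      rw [hf.nat 4 rfl, jobAt, dif_pos hk]; exact hσ ⟨k, hk⟩
    have k20 : s'.nat 20 (jobAt σ k) 0 = jobAt σ k / n := by rw [hf.nat 20 rfl, h20 _ hx]
    have k21 : s'.nat 21 (jobAt σ k) 0 = jobAt σ k % n := by rw [hf.nat 21 rfl, h21 _ hx]
    have hc : jobAt σ k / n < K := by rwa [Nat.div_lt_iff_lt_mul hn]
    refine Run.setNat_seq (Run.setNat_seq (Run.setNat_seq (Run.setNat ⟨fun c hcK => ?_,
      fun k' hk' => ?_⟩)))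
    · simp only [State.setNat_nat_same, State.setNat_nat_of_ne, NExp.eval, h9, k4, k20, k21, i1 _ hc,
        ne_eq, Nat.reduceEqDiff, not_false_eq_true, and_self, if_true, and_true, copyCount_succ]
      by_cases h : c = jobAt σ k / n
      · simp [h]
      · simp [h, Ne.symm h, i1 c hcK]
    · simp only [State.setNat_nat_same, State.setNat_nat_of_ne, NExp.eval, h9, k4, k20, k21, i1 _ hc,
        ne_eq, Nat.reduceEqDiff, not_false_eq_true, and_self, if_true]
      split_ifs with h
      -- Two positions that share a cell are equal, so nothing is overwritten.
      · rw [copyCount_injOn σ h.1 (h.1 ▸ h.2)]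
      · refine i2 k' ?_
        rcases Nat.lt_succ_iff_lt_or_eq.1 hk' with h' | rfl
        · exact h'
        · exact absurd ⟨rfl, rfl⟩ h
  · rintro s' - ⟨-, h⟩ c i
    obtain ⟨k, hk⟩ := (copyPosition σ hn).surjective (c, i)
    have h1 := copyPosition_fst σ hn k
    have h2 := copyPosition_snd σ hn k
    have h3 := copyTour_copyPosition σ hn k
    have h4 := h k k.2
    rw [hk] at h1 h2 h3
    simp only [jobAt_fin] at h4
    rw [h3, ← h4, h2, h1]

/-- Find the copy with the shortest tour. -/
def selectProg : Program :=
  .seq (.setVar 25 (.const 0)) (.forLoop 12 (.var 17)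
    (.seq (.setRVar 5 (.const 0))
      (.seq
        (.forLoop 9 (.var 0)
          (.seq
            (.ite (.natLe (.add (.add (.var 9) (.const 1)) (.const 1)) (.var 0))
              (.setVar 24 (.add (.var 9) (.const 1))) (.setVar 24 (.const 0)))
            (.setRVar 5 (.add (.var 5)
              (.read 0 (.read 23 (.var 12) (.var 9)) (.read 23 (.var 12) (.var 24)))))))
        (.ite (.and (.natLe (.const 1) (.var 12)) (.realLe (.var 6) (.var 5))) .skip
          (.seq (.setRVar 6 (.var 5)) (.setVar 25 (.var 12)))))))

/-- The invariant is void for `k = 0`, where the record length is not yet initialised; the first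
copy is therefore accepted without comparison. -/
theorem run_selectProg {G : ATSP} {ε : ℝ} {K : ℕ} (hK : 0 < K)
    (τ : Fin K → Equiv.Perm (Fin G.n)) {s : State} (hs : s.HoldsATSP G ε)
    (h17 : s.nat 17 0 0 = K) (hτ : ∀ (c : Fin K) (i : Fin G.n), s.nat 23 c i = τ c i) :
    Run selectProg s (K * (G.n * 5 + 8) + 3) fun s' => ∃ c : Fin K, s'.nat 25 0 0 = c ∧
      ∀ c', G.tourLength (τ c) ≤ G.tourLength (τ c') := by
  refine Run.mono (Run.setNat_seq (Run.forLoop (T := G.n * 5 + 6) K (fun k s' => 0 < k →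
    ∃ c : Fin K, (c : ℕ) < k ∧ s'.nat 25 0 0 = c ∧ s'.real 6 0 0 = G.tourLength (τ c) ∧
      ∀ c' : Fin K, (c' : ℕ) < k → G.tourLength (τ c) ≤ G.tourLength (τ c')) rfl ?_ ?_ ?_ ?_))
    le_rfl ?_
  · intro s' hf
    simp only [NExp.eval, hf.nat 17 rfl]
    simp [State.setNat_nat_of_ne, h17]
  · intro k v s' h
    simpa [State.setNat_nat_of_ne] using h
  · exact fun h => absurd h (lt_irrefl 0)
  · rintro k hk s1 hf1 h12 hi
    have hs1 := (hs.frame (p := .setVar 25 (.const 0)) (Exec.setNat s 25 _ _ _).frame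
      rfl rfl rfl).frame hf1 rfl rfl rfl
    have g23 : s1.nat 23 = s.nat 23 := by
      rw [hf1.nat 23 rfl]; exact State.setNat_nat_of_ne _ _ _ _ (by decide)
    set c : Fin K := ⟨k, hk⟩ with hc
    have hτc : ∀ i : Fin G.n, s1.nat 23 k i = τ c i := fun i => by rw [g23]; exact hτ c i
    refine Run.mono (Run.setReal_seq (Run.seq (T' := 3) (R := fun s' =>
      s'.real 5 0 0 = G.tourLength (τ c)) (Run.mono (Run.forLoop (T := 3) G.n (fun i s' =>
      s'.real 5 0 0 = ∑ j : Fin G.n, if (j : ℕ) < i then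
        G.d (τ c j) (τ c (finRotate G.n j)) else 0) rfl ?_ ?_ ?_ ?_) le_rfl ?_) ?_))
      (le_of_eq (by ring)) fun _ _ h => h
    · intro s' hf
      simp only [NExp.eval, hf.nat 0 rfl]
      simpa using hs1.n
    · intro k v s' h
      simpa using h
    · simp [State.setReal_real_same, RExp.eval, NExp.eval]
    · intro i hi s2 hf2 h9 h5
      have hs2 : s2.HoldsATSP G ε := ((hs1.frame (p := .setRVar 5 (.const 0))
        (Exec.setReal s1 5 _ _ _).frame rfl rfl rfl).frame hf2 rfl rfl rfl)
      have i12 : s2.nat 12 0 0 = k := by rw [hf2.nat 12 rfl]; exact h12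
      have i23 : s2.nat 23 = s1.nat 23 := by rw [hf2.nat 23 rfl]; rfl
      refine Run.seq (T := 2) (R := fun s' => s'.nat 24 0 0 = finRotate G.n ⟨i, hi⟩)
        (Run.ite (fun hb => Run.setNat ?_) fun hb => Run.setNat ?_) fun s3 hf3 h24 =>
          Run.setReal ?_
      · simp only [Test.eval, NExp.eval, h9, hs2.n] at hb
        rw [val_finRotate, if_pos (by simp only; omega)]
        simp [State.setNat_nat_same, NExp.eval, h9]
      · simp only [Test.eval, NExp.eval, h9, hs2.n] at hb
        rw [val_finRotate, if_neg (by simp only; omega)]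
        simp [State.setNat_nat_same, NExp.eval]
      · have hs3 := hs2.frame hf3 rfl rfl rfl
        have j12 : s3.nat 12 0 0 = k := by rw [hf3.nat 12 rfl, i12]
        have j9 : s3.nat 9 0 0 = i := by rw [hf3.nat 9 rfl, h9]
        have j5 := hf3.real 5 rfl
        have j23 : ∀ i : Fin G.n, s3.nat 23 k i = τ c i := fun i => by
          rw [hf3.nat 23 rfl, i23, hτc]
        have ji := j23 ⟨i, hi⟩
        simp only at ji
        have hd := hs3.d _ (τ c ⟨i, hi⟩).2 _ (τ c (finRotate G.n ⟨i, hi⟩)).2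
        simp only [ATSP.dist, Fin.is_lt, and_self, dif_pos, Fin.eta] at hd
        have hsplit : ∀ j : Fin G.n, (if (j : ℕ) < i + 1 then
            G.d (τ c j) (τ c (finRotate G.n j)) else 0) = (if (j : ℕ) < i then
            G.d (τ c j) (τ c (finRotate G.n j)) else 0) + if j = ⟨i, hi⟩ then
            G.d (τ c j) (τ c (finRotate G.n j)) else 0 := fun j => by
          have h1 : j = ⟨i, hi⟩ ↔ (j : ℕ) = i := Fin.ext_iff
          simp only [h1]
          rcases lt_trichotomy (j : ℕ) i with h | h | h
          · rw [if_pos (by omega), if_pos h, if_neg (by omega), add_zero]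
          · rw [if_pos (by omega), if_neg (by omega), if_pos h, zero_add]
          · rw [if_neg (by omega), if_neg (by omega), if_neg (by omega), add_zero]
        simp only [State.setReal_real_same, RExp.eval, NExp.eval, and_self, if_true, j12, j9, h24,
          ji, j23, hd, j5, h5, hsplit, Finset.sum_add_distrib]
        simp
    · intro s' _ h
      simpa [ATSP.tourLength] using h
    · intro s2 hf2 h5
      have i12 : s2.nat 12 0 0 = k := by rw [hf2.nat 12 rfl]; exact h12
      have i25 : s2.nat 25 = s1.nat 25 := by rw [hf2.nat 25 rfl]; rfl
      have i6 : s2.real 6 = s1.real 6 := by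
        rw [hf2.real 6 rfl]; exact State.setReal_real_of_ne _ _ _ _ (by decide)
      refine Run.ite (T := 2) (fun hb => Run.mono (T := 1) (Run.skip fun _ => ?_) (by omega)
        fun _ _ h => h) fun hb => Run.setReal_seq (Run.setNat fun _ => ⟨c, ?_, ?_, ?_, ?_⟩)
      · simp only [Test.eval, RExp.eval, NExp.eval, i12, h5, i6] at hb
        obtain ⟨c₀, h1, h2, h3, h4⟩ := hi hb.1
        refine ⟨c₀, by omega, by rw [i25, h2], by rw [i6, h3], fun c' hc' => ?_⟩
        rcases Nat.lt_succ_iff_lt_or_eq.1 hc' with h | h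
        · exact h4 c' h
        · have : c' = c := Fin.ext h
          rw [this, ← h3]
          exact hb.2
      · simp [hc]
      · simp [State.setNat_nat_same, NExp.eval, i12, hc]
      · simp [State.setReal_real_same, NExp.eval, RExp.eval, h5]
      · intro c' hc'
        rcases Nat.lt_succ_iff_lt_or_eq.1 hc' with h | h
        · obtain ⟨c₀, h1, h2, h3, h4⟩ := hi (by omega)
          simp only [Test.eval, RExp.eval, NExp.eval, i12, h5, i6, h3, not_and, not_le] at hb
          exact (hb (by omega)).le.trans (h4 c' h)
        · have : c' = c := Fin.ext h
          rw [this]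
  · rintro s' - h
    obtain ⟨c, -, h1, -, h2⟩ := h hK
    exact ⟨c, h1, fun c' => h2 c' c'.2⟩

/-- Output the tour of the selected copy. -/
def outputProg : Program :=
  .forLoop 9 (.var 0) (.setNat 5 (.var 9) (.const 0) (.read 23 (.var 25) (.var 9)))

theorem run_outputProg {n : ℕ} {s : State} (h0 : s.nat 0 0 0 = n) (τ : Equiv.Perm (Fin n))
    (hτ : ∀ i : Fin n, s.nat 23 (s.nat 25 0 0) i = τ i) :
    Run outputProg s (n * 3 + 2) fun s' => s'.HoldsTour τ := by
  refine Run.mono (Run.forLoop (T := 1) n (fun k s' => ∀ i : Fin n, (i : ℕ) < k →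
    s'.nat 5 i 0 = τ i) rfl ?_ ?_ ?_ ?_) le_rfl fun s' _ h i => h i i.2
  · intro s' hf
    simp only [NExp.eval, hf.nat 0 rfl, h0]
  · intro k v s' h
    simpa [State.setNat_nat_of_ne] using h
  · exact fun i hi => absurd hi (Nat.not_lt_zero _)
  · intro k hk s' hf h9 h5
    refine Run.setNat fun i hi => ?_
    have := hτ ⟨k, hk⟩
    simp only [State.setNat_nat_same, NExp.eval, h9, hf.nat 23 rfl, hf.nat 25 rfl, and_true]
    split_ifs with h
    · subst h
      exact this
    · exact h5 i (by omega)

/-- The program that turns a job order into a tour. -/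
def recoverProg : Program := .seq buildProg (.seq scanProg (.seq selectProg outputProg))

/-- A bound for the running time of the extraction. -/
def recoverTime (n P e : ℕ) : ℕ :=
  buildTime n P e + ((P * P * n * 6 + 2) + ((P * P * (n * 5 + 8) + 3) + (n * 3 + 2)))

theorem run_recoverProg {G : ATSP} {ε : ℝ} (hε : 0 < ε) {s : State} (hs : s.HoldsATSP G ε)
    (σ : Equiv.Perm (Fin (G.scale ε * G.scale ε * G.n))) (hσ : s.HoldsSchedule σ) :
    Run recoverProg s (recoverTime G.n (G.scale ε) ⌈9 / ε⌉₊) fun s' =>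
      ∃ c : Fin (G.scale ε * G.scale ε), s'.HoldsTour (copyTour σ G.n_pos c) ∧
        ∀ c', G.tourLength (copyTour σ G.n_pos c) ≤ G.tourLength (copyTour σ G.n_pos c') := by
  refine Run.seq (run_buildProg hε hs) fun s1 hf1 h1 => ?_
  refine Run.seq (run_scanProg G.n_pos σ (fun k => by rw [hf1.nat 4 rfl]; exact hσ k)
    h1.jobs.count h1.jobs.copy h1.jobs.vertex h1.copies.zero) fun s2 hf2 h2 => ?_
  have hs2 := h1.input.frame hf2 rfl rfl rfl
  refine Run.seq (run_selectProg (Nat.mul_pos (G.scale_pos hε) (G.scale_pos hε)) _ hs2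
    (by rw [hf2.nat 17 rfl]; exact h1.copies.count) h2) fun s3 hf3 h3 => ?_
  obtain ⟨c, hc, hmin⟩ := h3
  refine Run.mono (run_outputProg (hs2.frame hf3 rfl rfl rfl).n (copyTour σ G.n_pos c) fun i => ?_)
    le_rfl fun s' _ h => ⟨c, h, hmin⟩
  rw [hf3.nat 23 rfl, hc, h2]

/-! ### Polynomial bounds -/

theorem buildTime_le_recoverTime (n P e : ℕ) : buildTime n P e ≤ recoverTime n P e :=
  Nat.le_add_right _ _

theorem recoverTime_mono {n n' P P' e e' : ℕ} (hn : n ≤ n') (hP : P ≤ P') (he : e ≤ e') :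
    recoverTime n P e ≤ recoverTime n' P' e' := by
  unfold recoverTime buildTime
  gcongr

theorem recoverTime_le {y : ℕ} (hy : 0 < y) : recoverTime y (y ^ 2) y ≤ 1000 * y ^ 9 := by
  -- The dominant terms have order P⁴n, which is `y ^ 9` for P = y² and n = y. Bounding every lower
  -- power by `y ^ 9` leaves a linear inequality.
  have h : ∀ i ≤ 9, y ^ i ≤ y ^ 9 := fun i hi => Nat.pow_le_pow_right hy hi
  have h0 := h 0 (by omega)
  have h1 := h 1 (by omega)
  have h2 := h 2 (by omega)
  have h3 := h 3 (by omega)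
  have h4 := h 4 (by omega)
  have h5 := h 5 (by omega)
  have h6 := h 6 (by omega)
  have h7 := h 7 (by omega)
  have h8 := h 8 (by omega)
  unfold recoverTime buildTime
  ring_nf at *
  omega

namespace ATSP

variable (G : ATSP) {ε : ℝ}

/-- A natural number that is linear in `n` and `1 / ε`. -/
noncomputable def bound (ε : ℝ) : ℕ := G.n + ⌈9 / ε⌉₊

theorem scale_le (ε : ℝ) : G.scale ε ≤ G.bound ε ^ 2 := by
  unfold scale bound
  nlinarith [Nat.zero_le (G.n * ⌈9 / ε⌉₊)]

theorem bound_le (hε : 0 < ε) : (G.bound ε : ℝ) ≤ 9 * ((G.n : ℝ) + 1 / ε + 1) := by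
  have h := (Nat.ceil_lt_add_one (show 0 ≤ 9 / ε by positivity)).le
  have e : 9 / ε = 9 * (1 / ε) := by ring
  have hn : (0 : ℝ) ≤ G.n := Nat.cast_nonneg _
  unfold bound
  push_cast
  linarith

theorem le_polyBound (hε : 0 < ε) {T : ℕ} (hT : T ≤ 1000 * G.bound ε ^ 9) :
    (T : ℝ) ≤ polyBound (1000 * 9 ^ 9) 9 G.n ε := by
  have h1 : (T : ℝ) ≤ 1000 * (G.bound ε : ℝ) ^ 9 := by exact_mod_cast hT
  have h2 := pow_le_pow_left₀ (Nat.cast_nonneg _) (G.bound_le hε) 9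
  rw [mul_pow] at h2
  unfold polyBound
  push_cast
  linarith

theorem recoverTime_le_polyBound (hε : 0 < ε) :
    (recoverTime G.n (G.scale ε) ⌈9 / ε⌉₊ : ℝ) ≤ polyBound (1000 * 9 ^ 9) 9 G.n ε :=
  G.le_polyBound hε ((recoverTime_mono (Nat.le_add_right _ _) (G.scale_le ε)
    (Nat.le_add_left _ _)).trans (recoverTime_le (Nat.add_pos_left G.n_pos _)))

theorem size_le_polyBound (hε : 0 < ε) :
    ((G.toNWFS hε).size : ℝ) ≤ polyBound (1000 * 9 ^ 9) 9 G.n ε := by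
  refine G.le_polyBound hε ((flow_size_le G.n_pos (G.scale_pos hε)).trans ?_)
  have hy : 0 < G.bound ε := Nat.add_pos_left G.n_pos _
  have hn : G.n ≤ G.bound ε := Nat.le_add_right _ _
  have hP := G.scale_le ε
  set y := G.bound ε
  calc G.scale ε * G.scale ε * G.n * ((G.n + 2 * G.scale ε) * (2 * G.scale ε) * 3)
      ≤ y ^ 2 * y ^ 2 * y * ((y ^ 2 + 2 * y ^ 2) * (2 * y ^ 2) * 3) := by
        have : G.n ≤ y ^ 2 := hn.trans (Nat.le_self_pow (by omega) y)
        gcongr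
    _ = 18 * y ^ 9 := by ring
    _ ≤ 1000 * y ^ 9 := by gcongr; omega

theorem input_holdsATSP (ε : ℝ) : (G.input ε).HoldsATSP G ε where
  n := by simp [input]
  d u hu v hv := by simp [input, dist, hu, hv]
  eps := by simp [input]

theorem inputWithSchedule_holdsATSP (ε : ℝ) {N : ℕ} (σ : Equiv.Perm (Fin N)) :
    (G.inputWithSchedule ε σ).HoldsATSP G ε where
  n := by simp [inputWithSchedule, input]
  d u hu v hv := by simp [inputWithSchedule, input, dist, hu, hv]
  eps := by simp [inputWithSchedule, input]

theorem inputWithSchedule_holdsSchedule (ε : ℝ) {N : ℕ} (σ : Equiv.Perm (Fin N)) :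
    (G.inputWithSchedule ε σ).HoldsSchedule σ := fun k => by
  simp [inputWithSchedule]

end ATSP

theorem Run.haltsWithin {p : Program} {s : State} {T : ℕ} {B : ℝ} {Q : State → Prop}
    (h : Run p s T Q) (hT : (T : ℝ) ≤ B) : p.HaltsWithin s B Q := by
  obtain ⟨s', t, e, ht, hq⟩ := h
  exact ⟨s', t, e, (Nat.cast_le.2 ht).trans hT, hq⟩

theorem State.Built.holdsInstance {G : ATSP} {ε : ℝ} (hε : 0 < ε) {s s₀ : State}
    (h : s.Built s₀ G ε) : s.HoldsInstance (G.toNWFS hε) :=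
  ⟨by simpa using h.numJobs 0 0, by simpa using h.numMachines 0 0, fun j k => by
    rw [h.jobs.time, if_pos ⟨j.2, k.2⟩]⟩

/-! ### Using a flowshop algorithm as a subroutine -/

/-- The new names of the natural-number arrays of the subroutine: those for its input and output
are kept. -/
def natName (x : ℕ) : ℕ := if 1 ≤ x ∧ x ≤ 4 then x else x + 100

/-- The new names of the real arrays of the subroutine. -/
def realName (x : ℕ) : ℕ := x + 100

theorem natName_injective : natName.Injective := fun x y h => by
  unfold natName at h
  split_ifs at h <;> omega

theorem realName_injective : realName.Injective := add_left_injective 100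

theorem buildProg_writesNat {x : ℕ} (hx : 100 ≤ x) : buildProg.writesNat x = false := by
  simp [buildProg, scaleProg, diamProg, weightProg, jobsProg, jobProg, coordProg, waveProg,
    Program.forLoop, Program.writesNat]
  omega

theorem buildProg_writesReal {x : ℕ} (hx : 100 ≤ x) : buildProg.writesReal x = false := by
  simp [buildProg, scaleProg, diamProg, weightProg, jobsProg, jobProg, coordProg, waveProg,
    Program.forLoop, Program.writesReal]
  omega

/-- The guarantee for the subroutine applies only to a memory equal to its input, so every other
visible cell must be 0. This holds because the construction writes neither to array `4` nor to any
array from 100 on. -/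
theorem State.Built.pull_eq_input {G : ATSP} {ε : ℝ} (hε : 0 < ε) {s : State}
    (h : s.Built (G.input ε) G ε) (hf : Frame buildProg (G.input ε) s) :
    s.pull natName realName = (G.toNWFS hε).input := by
  have hnat : (s.pull natName realName).nat = ((G.toNWFS hε).input).nat := by
    funext x i j
    by_cases h1 : x = 1
    · subst h1
      have : (s.pull natName realName).nat 1 i j = s.nat 1 i j := rfl
      rw [this, h.numJobs]
      simp [NWFS.input, ATSP.input]
    by_cases h2 : x = 2
    · subst h2
      have : (s.pull natName realName).nat 2 i j = s.nat 2 i j := rfl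
      rw [this, h.numMachines]
      simp [NWFS.input, ATSP.input]
    by_cases h3 : x = 3
    · subst h3
      have : (s.pull natName realName).nat 3 i j = s.nat 3 i j := rfl
      rw [this, h.jobs.time]
      simp [NWFS.input, ATSP.input]
    have hz : ((G.toNWFS hε).input).nat x i j = 0 := by simp [NWFS.input, h1, h2, h3]
    rw [hz]
    change s.nat (natName x) i j = 0
    have : s.nat (natName x) = (G.input ε).nat (natName x) := by
      by_cases h4 : x = 4
      · subst h4
        exact hf.nat 4 rfl
      · exact hf.nat _ (buildProg_writesNat (by unfold natName; split_ifs <;> omega))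
    rw [this]
    have : natName x ≠ 0 := by unfold natName; split_ifs <;> omega
    simp [ATSP.input, this]
  have hreal : (s.pull natName realName).real = ((G.toNWFS hε).input).real := by
    funext x i j
    change s.real (x + 100) i j = 0
    rw [hf.real _ (buildProg_writesReal (by omega))]
    simp [ATSP.input]
  calc s.pull natName realName
      = ⟨(s.pull natName realName).nat, (s.pull natName realName).real⟩ := rfl
    _ = _ := by rw [hnat, hreal]

/-- `recoverProg` rebuilds the instance itself, so only `G`, `ε` and the job order have to survive
the subroutine. -/
theorem isApproxSchemeATSP {α : ℝ} (hα : 1 ≤ α) {A : Program} (hA : IsApproxAlgNWFS α A) :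
    IsApproxSchemeATSP α
      (.seq buildProg (.seq (A.rename natName realName) recoverProg)) := by
  obtain ⟨c, k, hA⟩ := hA
  -- With M = 1000·9⁹ and X = n + 1/ε + 1, building and recovering each take at most MX⁹, and the
  -- subroutine at most c(MX⁹)^k; since X ≥ 1, the exponent `9 + 9 * k` dominates both.
  refine ⟨2 * (1000 * 9 ^ 9) + c * (1000 * 9 ^ 9) ^ k, 9 + 9 * k, fun G ε hε => ?_⟩
  obtain ⟨s1, t1, e1, ht1, h1⟩ := run_buildProg hε (G.input_holdsATSP ε)
  obtain ⟨s2, t2, e2, ht2, σ, hσ, hap⟩ := hA (G.toNWFS hε)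
  obtain ⟨S2, E2, hS2⟩ := e2.rename natName_injective realName_injective s1
    (h1.pull_eq_input hε e1.frame)
  have hsch : S2.HoldsSchedule σ := fun i => by
    have := hσ i
    rw [← hS2] at this
    exact this
  have hS : S2.HoldsATSP G ε := by
    refine h1.input.frame E2.frame (Program.writesNat_rename ?_ A) (Program.writesReal_rename ?_ A)
      (Program.writesReal_rename ?_ A)
    · rintro ⟨x, hx⟩
      unfold natName at hx
      split_ifs at hx; omega
    · rintro ⟨x, hx⟩
      unfold realName at hx
      omega
    · rintro ⟨x, hx⟩
      unfold realName at hx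
      omega
  obtain ⟨s3, t3, e3, ht3, b, hb, hmin⟩ := run_recoverProg hε hS σ hsch
  refine ⟨s3, _, e1.seq (E2.seq e3), ?_, _, hb, G.tourLength_copyTour_le hε hα σ hap b hmin⟩
  have hT := G.recoverTime_le_polyBound hε
  have hsize := G.size_le_polyBound hε
  have hb1 : (t1 : ℝ) ≤ recoverTime G.n (G.scale ε) ⌈9 / ε⌉₊ :=
    Nat.cast_le.2 (ht1.trans (buildTime_le_recoverTime _ _ _))
  have hb3 : (t3 : ℝ) ≤ recoverTime G.n (G.scale ε) ⌈9 / ε⌉₊ := Nat.cast_le.2 ht3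
  unfold polyBound at hT hsize ⊢
  set X : ℝ := (G.n : ℝ) + 1 / ε + 1 with hX
  have hX1 : 1 ≤ X := by
    have : (0 : ℝ) ≤ G.n := Nat.cast_nonneg _
    have : 0 < 1 / ε := by positivity
    linarith
  have hX0 : 0 ≤ X := by linarith
  have h9 : X ^ 9 ≤ X ^ (9 + 9 * k) := pow_le_pow_right₀ hX1 (by omega)
  have h9k : (X ^ 9) ^ k ≤ X ^ (9 + 9 * k) := by
    rw [← pow_mul]
    exact pow_le_pow_right₀ hX1 (by omega)
  have hb2 : (t2 : ℝ) ≤ c * (((1000 * 9 ^ 9 : ℕ) : ℝ) ^ k * X ^ (9 + 9 * k)) := by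
    refine ht2.trans (mul_le_mul_of_nonneg_left ?_ (Nat.cast_nonneg _))
    refine (pow_le_pow_left₀ (Nat.cast_nonneg _) hsize k).trans ?_
    rw [mul_pow]
    exact mul_le_mul_of_nonneg_left h9k (by positivity)
  push_cast at hT hb2 ⊢
  linarith

end FlowshopATSP

theorem mainTheorem1 :
    (∃ (build recover : FlowshopATSP.Program) (C : ℝ) (c k : ℕ),
      ∀ (G : FlowshopATSP.ATSP) (ε : ℝ), 0 < ε →
        ∃ I : FlowshopATSP.NWFS,
          (I.size : ℝ) ≤ FlowshopATSP.polyBound c k G.n ε ∧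
          build.HaltsWithin (G.input ε) (FlowshopATSP.polyBound c k G.n ε)
            (fun s => s.HoldsInstance I) ∧
          ∀ σ : Equiv.Perm (Fin I.jobs), ∃ τ : Equiv.Perm (Fin G.n),
            recover.HaltsWithin (G.inputWithSchedule ε σ) (FlowshopATSP.polyBound c k G.n ε)
              (fun s => s.HoldsTour τ) ∧
            ∀ α : ℝ, 1 ≤ α → I.IsApprox α σ →
              G.tourLength τ ≤ α * (1 + C * ε) * G.opt) ∧
    (∀ α : ℝ, 1 ≤ α →
      (∃ A : FlowshopATSP.Program, FlowshopATSP.IsApproxAlgNWFS α A) →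
        ∃ B : FlowshopATSP.Program, FlowshopATSP.IsApproxSchemeATSP α B) := by
  -- The accuracy of `scale` is tuned so that C = 1 suffices.
  refine ⟨⟨FlowshopATSP.buildProg, FlowshopATSP.recoverProg, 1, 1000 * 9 ^ 9, 9,
    fun G ε hε => ⟨G.toNWFS hε, G.size_le_polyBound hε, ?_, fun σ => ?_⟩⟩, ?_⟩
  · have hT : (FlowshopATSP.buildTime G.n (G.scale ε) ⌈9 / ε⌉₊ : ℝ) ≤ _ :=
      Nat.cast_le.2 (FlowshopATSP.buildTime_le_recoverTime _ _ _)
    exact ((FlowshopATSP.run_buildProg hε (G.input_holdsATSP ε)).mono le_rfl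
      fun _ _ h => h.holdsInstance hε).haltsWithin (hT.trans (G.recoverTime_le_polyBound hε))
  · obtain ⟨s', t, e, ht, b, hb, hmin⟩ := FlowshopATSP.run_recoverProg hε
      (G.inputWithSchedule_holdsATSP ε σ) σ (G.inputWithSchedule_holdsSchedule ε σ)
    refine ⟨_, ⟨s', t, e, (Nat.cast_le.2 ht).trans (G.recoverTime_le_polyBound hε), hb⟩,
      fun α hα hσ => ?_⟩
    rw [one_mul]
    exact G.tourLength_copyTour_le hε hα σ hσ b hmin
  · rintro α hα ⟨A, hA⟩
    exact ⟨_, FlowshopATSP.isApproxSchemeATSP hα hA⟩
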